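/- Let $N\ge 0$ be an integer. For $\mathbf k=(k_1,\dots,k_N)\in[0,1]^N$ write $\mathbf k_j=(k_{j+1},\dots,k_N)\in[0,1]^{N-j}$, and for $1\le j\le N$ let $\langle u\rangle_{1,j}=\int_{[0,1]^j}u\,dk_1\cdots dk_j$ and $\langle u\rangle_j=\int_0^1u\,dk_j$. To real continuous functions $A_j=A_j(\mathbf k_j)$ on $[0,1]^{N-j}$, $j=0,\dots,N$ (so $A_N$ is a constant), associate the operator $$\mathcal A u=A_0u+A_1\langle u\rangle_{1,1}+\dots+A_N\langle u\rangle_{1,N}\qquad\text{on }L^2([0,1]^N,\mathbb C),$$ the integral continued fractions $F_0(\lambda,\mathbf k_0)=A_0(\mathbf k_0)-\lambda$, $F_j(\lambda,\mathbf k_j)=A_j(\mathbf k_j)+\langle F_{j-1}^{-1}(\lambda,k_j,\mathbf k_j)\rangle_j^{-1}$, and, recursively in $j$, the Floquet–Bloch branches $$\lambda_j(\mathbf k_j)=\Big\{\lambda\in\mathbb R\setminus\bigcup_{r=0}^{j-1}\lambda_r([0,1]^{j-r},\mathbf k_j):\ F_j(\lambda,\mathbf k_j)=0\Big\},$$ where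 $\lambda_r([0,1]^{j-r},\mathbf k_j)$ is the union of the sets $\lambda_r(k_{r+1},\dots,k_j,\mathbf k_j)$ over $(k_{r+1},\dots,k_j)\in[0,1]^{j-r}$. Put $\sigma_j=\lambda_j([0,1]^{N-j})=\bigcup_{\mathbf k_j}\lambda_j(\mathbf k_j)$. (i) For every such operator $\mathcal A$, each set $\lambda_j(\mathbf k_j)$ has at most one element, and the spectrum of $\mathcal A$ is $\sigma(\mathcal A)=\bigcup_{j=0}^N\sigma_j$. Each $\sigma_j$ with $j<N$ is a (possibly empty) union of at most countably many intervals (possibly degenerate to points), and it is a single compact interval if $\lambda_j(\mathbf k_j)\neq\emptyset$ for all $\mathbf k_j$; the set $\bigcup_{j<N}\sigma_j$ is a union of at most $N$ compact intervals. The set $\sigma_N$ has at most one element, and that element, if it exists, is an eigenvalue of $\mathcal A$. (ii) Let $\lambda_r=\lambda_r(\mathbf k_r)$, $r=0,\dots,N$, be real continuous functions on $[0,1]^{N-r}$ such that $$\lambda_j(\mathbf k_j)\notin\bigcup_{r=0}^{j-1}\lambda_r([0,1]^{j-r},\mathbf k_j)\qquad\text{for all }j\ge1\text{ and all }\mathbf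 k_j\in[0,1]^{N-j}.$$ Then there is exactly one operator $\mathcal A$ of the above form whose Floquet–Bloch branches are the one-element sets $\{\lambda_j(\mathbf k_j)\}$, and its components are unique. They are given inductively by $A_0=\lambda_0$ and $$A_j(\mathbf k_j)=-\big\langle F_{j-1}^{-1}(\lambda_j(\mathbf k_j),k_j,\mathbf k_j)\big\rangle_j^{-1},\qquad j\ge1,$$ where $F_{j-1}(\lambda_j(\mathbf k_j),k_j,\mathbf k_j)\ne0$ for all $k_j\in[0,1]$ and the integral is finite and non-zero. The spectrum of $\mathcal A$ is $\bigcup_{r=0}^N\lambda_r([0,1]^{N-r})$. -/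

import Mathlib

open MeasureTheory
open scoped unitInterval ENNReal

noncomputable section

namespace PeriodicDefects

/-- The cube `[0,1]^N` with its product topology and Lebesgue measure. The coordinate written
`k_{i+1}` in the mathematics is `k i`, `i : Fin N`. -/
abbrev Cube (N : ℕ) : Type := Fin N → I

/-- A family of real continuous functions `f_0, …, f_N` on `[0,1]^N` such that `f_j` depends only on
`𝐤_j = (k_{j+1}, …, k_N)`; that is, `f_j` is a real continuous function on `[0,1]^{N-j}`. -/
@[ext]
structure TailFamily (N : ℕ) where
  /-- the functions -/
  toFun : Fin (N + 1) → C(Cube N, ℝ)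
  /-- `f_j` is a function of `k_{j+1}, …, k_N` only -/
  dependsOn_tail : ∀ j : Fin (N + 1), DependsOn (toFun j) {i : Fin N | j.val ≤ i.val}

instance (N : ℕ) : CoeFun (TailFamily N) (fun _ => Fin (N + 1) → C(Cube N, ℝ)) :=
  ⟨TailFamily.toFun⟩

/-- `SameTail j k k'` says that `k` and `k'` have the same `𝐤_j = (k_{j+1}, …, k_N)`. -/
def SameTail {N : ℕ} (j : Fin (N + 1)) (k k' : Cube N) : Prop :=
  ∀ i : Fin N, j.val ≤ i.val → k i = k' i

/-! ### The operator -/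

/-- The Hilbert space `L²([0,1]^N, ℂ)`. -/
abbrev L2 (N : ℕ) : Type := Lp ℂ 2 (volume : Measure (Cube N))

/-- The point `(s_1, …, s_j, k_{j+1}, …, k_N)`. -/
def merge {N : ℕ} (j : Fin (N + 1)) (s : {i : Fin N // i.val < j.val} → I) (k : Cube N) : Cube N :=
  fun i => if h : i.val < j.val then s ⟨i, h⟩ else k i

/-- `⟨u⟩_{1,j}`, the integral of `u` over the variables `k_1, …, k_j` (`u` itself for `j = 0`). -/
def avg {N : ℕ} (j : Fin (N + 1)) (u : Cube N → ℂ) (k : Cube N) : ℂ :=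
  ∫ s : {i : Fin N // i.val < j.val} → I, u (merge j s k)

theorem measurePreserving_merge {N : ℕ} (j : Fin (N + 1)) :
    MeasurePreserving
      (fun z : Cube N × ({i : Fin N // i.val < j.val} → I) => merge j z.2 z.1)
      (volume.prod volume) volume := by
  have e := volume_preserving_piEquivPiSubtypeProd (fun _ : Fin N => I) (fun i => i.val < j.val)
  have h1 : MeasurePreserving
      (fun k : Cube N => fun i : {i : Fin N // ¬ i.val < j.val} => k i.1) volume volume :=
    measurePreserving_snd.comp e
  have h2 := (MeasurePreserving.id
    (volume : Measure ({i : Fin N // i.val < j.val} → I))).prod h1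
  have h3 := (e.symm.comp h2).comp
    (Measure.measurePreserving_swap (μ := (volume : Measure (Cube N)))
      (ν := (volume : Measure ({i : Fin N // i.val < j.val} → I))))
  exact h3

theorem avg_congr {N : ℕ} (j : Fin (N + 1)) {u v : Cube N → ℂ} (h : u =ᵐ[volume] v) :
    avg j u =ᵐ[volume] avg j v := by
  have h1 := Measure.ae_ae_of_ae_prod ((measurePreserving_merge j).quasiMeasurePreserving.ae h)
  filter_upwards [h1] with k hk
  exact integral_congr_ae hk

theorem ae_integrable_merge {N : ℕ} (j : Fin (N + 1)) {u : Cube N → ℂ} (hu : Integrable u) :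
    ∀ᵐ k : Cube N, Integrable (fun s => u (merge j s k)) := by
  have h := ((measurePreserving_merge j).integrable_comp hu.aestronglyMeasurable).2 hu
  exact h.prod_right_ae

theorem eLpNorm_avg_le {N : ℕ} (j : Fin (N + 1)) {u : Cube N → ℂ}
    (hu : AEStronglyMeasurable u volume) : eLpNorm (avg j u) 2 volume ≤ eLpNorm u 2 volume := by
  have hm := (measurePreserving_merge j)
  have hu' := hu.comp_measurePreserving hm
  rw [← eLpNorm_comp_measurePreserving hu hm]
  have key : ∀ᵐ k : Cube N, ‖avg j u k‖ₑ ^ (2 : ℝ) ≤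
      ∫⁻ s : {i : Fin N // i.val < j.val} → I, ‖u (merge j s k)‖ₑ ^ (2 : ℝ) := by
    filter_upwards [hu'.prodMk_left] with k hk
    have h1 : ‖avg j u k‖ₑ ≤ eLpNorm (fun s => u (merge j s k)) 2 volume :=
      calc ‖avg j u k‖ₑ ≤ eLpNorm (fun s => u (merge j s k)) 1 volume := by
            rw [eLpNorm_one_eq_lintegral_enorm]
            exact enorm_integral_le_lintegral_enorm _
        _ ≤ _ := eLpNorm_le_eLpNorm_of_exponent_le (by norm_num) hk
    calc ‖avg j u k‖ₑ ^ (2 : ℝ) ≤ (eLpNorm (fun s => u (merge j s k)) 2 volume) ^ (2 : ℝ) := by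
          gcongr
      _ = _ := by
          rw [eLpNorm_eq_lintegral_rpow_enorm_toReal (by norm_num) (by norm_num),
            ← ENNReal.rpow_mul]
          norm_num
  rw [eLpNorm_eq_lintegral_rpow_enorm_toReal (by norm_num) (by norm_num),
    eLpNorm_eq_lintegral_rpow_enorm_toReal (by norm_num) (by norm_num)]
  refine ENNReal.rpow_le_rpow ?_ (by norm_num)
  simp only [ENNReal.toReal_ofNat]
  rw [lintegral_prod _ (hu'.enorm.pow_const _)]
  exact lintegral_mono_ae key

theorem memLp_avg {N : ℕ} (j : Fin (N + 1)) {u : Cube N → ℂ} (hu : MemLp u 2 volume) :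
    MemLp (avg j u) 2 volume := by
  refine ⟨?_, (eLpNorm_avg_le j hu.1).trans_lt hu.2⟩
  exact (hu.1.comp_measurePreserving (measurePreserving_merge j)).integral_prod_right'

/-- The bounded operator `u ↦ ⟨u⟩_{1,j}` on `L²([0,1]^N, ℂ)`. -/
def avgL {N : ℕ} (j : Fin (N + 1)) : L2 N →L[ℂ] L2 N :=
  LinearMap.mkContinuous
    { toFun := fun u => (memLp_avg j (Lp.memLp u)).toLp (avg j u)
      map_add' := fun u v => by
        apply Lp.ext
        have hu : Integrable (u : Cube N → ℂ) := (Lp.memLp u).integrable (by norm_num)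
        have hv : Integrable (v : Cube N → ℂ) := (Lp.memLp v).integrable (by norm_num)
        filter_upwards [MemLp.coeFn_toLp (memLp_avg j (Lp.memLp (u + v))),
          Lp.coeFn_add ((memLp_avg j (Lp.memLp u)).toLp (avg j u))
            ((memLp_avg j (Lp.memLp v)).toLp (avg j v)),
          MemLp.coeFn_toLp (memLp_avg j (Lp.memLp u)), MemLp.coeFn_toLp (memLp_avg j (Lp.memLp v)),
          avg_congr j (Lp.coeFn_add u v), ae_integrable_merge j hu, ae_integrable_merge j hv]
          with k h1 h2 h3 h4 h5 h6 h7
        rw [h1, h2, Pi.add_apply, h3, h4, h5]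
        exact integral_add h6 h7
      map_smul' := fun c u => by
        apply Lp.ext
        filter_upwards [MemLp.coeFn_toLp (memLp_avg j (Lp.memLp (c • u))),
          Lp.coeFn_smul c ((memLp_avg j (Lp.memLp u)).toLp (avg j u)),
          MemLp.coeFn_toLp (memLp_avg j (Lp.memLp u)),
          avg_congr j (Lp.coeFn_smul c u)] with k h1 h2 h3 h5
        rw [h1, RingHom.id_apply, h2, Pi.smul_apply, h3, h5]
        exact integral_smul c _ }
    1 (fun u => by
      rw [one_mul]
      change ‖(memLp_avg j (Lp.memLp u)).toLp (avg j u)‖ ≤ _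
      rw [Lp.norm_toLp, Lp.norm_def]
      exact ENNReal.toReal_mono (Lp.eLpNorm_ne_top u)
        (eLpNorm_avg_le j (Lp.memLp u).1))

theorem avgL_apply {N : ℕ} (j : Fin (N + 1)) (u : L2 N) :
    avgL j u =ᵐ[volume] avg j u :=
  MemLp.coeFn_toLp (memLp_avg j (Lp.memLp u))

theorem memLp_mul {N : ℕ} (a : C(Cube N, ℝ)) {u : Cube N → ℂ} (hu : MemLp u 2 volume) :
    MemLp (fun k => (a k : ℂ) * u k) 2 volume := by
  refine hu.of_le_mul (c := ‖a‖) ?_ (Filter.Eventually.of_forall fun k => ?_)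
  · exact (Complex.continuous_ofReal.comp a.continuous).aestronglyMeasurable.mul hu.1
  · rw [norm_mul, Complex.norm_real]
    gcongr
    exact a.norm_coe_le_norm k

/-- The bounded operator of multiplication by the real continuous function `a`. -/
def mulL {N : ℕ} (a : C(Cube N, ℝ)) : L2 N →L[ℂ] L2 N :=
  LinearMap.mkContinuous
    { toFun := fun u => (memLp_mul a (Lp.memLp u)).toLp (fun k => (a k : ℂ) * u k)
      map_add' := fun u v => by
        apply Lp.ext
        filter_upwards [MemLp.coeFn_toLp (memLp_mul a (Lp.memLp (u + v))),
          Lp.coeFn_add ((memLp_mul a (Lp.memLp u)).toLp _) ((memLp_mul a (Lp.memLp v)).toLp _),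
          MemLp.coeFn_toLp (memLp_mul a (Lp.memLp u)), MemLp.coeFn_toLp (memLp_mul a (Lp.memLp v)),
          Lp.coeFn_add u v] with k h1 h2 h3 h4 h5
        rw [h1, h2, Pi.add_apply, h3, h4, h5, Pi.add_apply, mul_add]
      map_smul' := fun c u => by
        apply Lp.ext
        filter_upwards [MemLp.coeFn_toLp (memLp_mul a (Lp.memLp (c • u))),
          Lp.coeFn_smul c ((memLp_mul a (Lp.memLp u)).toLp _),
          MemLp.coeFn_toLp (memLp_mul a (Lp.memLp u)), Lp.coeFn_smul c u] with k h1 h2 h3 h5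
        rw [h1, RingHom.id_apply, h2, Pi.smul_apply, h3, h5, Pi.smul_apply, smul_eq_mul,
          smul_eq_mul, mul_left_comm] }
    ‖a‖ (fun u => by
      change ‖(memLp_mul a (Lp.memLp u)).toLp (fun k => (a k : ℂ) * u k)‖ ≤ _
      apply Lp.norm_le_mul_norm_of_ae_le_mul
      filter_upwards [MemLp.coeFn_toLp (memLp_mul a (Lp.memLp u))] with k h1
      rw [h1, norm_mul, Complex.norm_real]
      gcongr
      exact a.norm_coe_le_norm k)

theorem mulL_apply {N : ℕ} (a : C(Cube N, ℝ)) (u : L2 N) :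
    mulL a u =ᵐ[volume] fun k => (a k : ℂ) * u k :=
  MemLp.coeFn_toLp (memLp_mul a (Lp.memLp u))

/-- The periodic operator with defects
`𝒜 u = A_0 u + A_1 ⟨u⟩_1 + … + A_N ⟨u⟩_{1,N}` on `L²([0,1]^N, ℂ)`. -/
def periodicOp {N : ℕ} (A : TailFamily N) : L2 N →L[ℂ] L2 N :=
  ∑ j : Fin (N + 1), (mulL (A j)).comp (avgL j)

theorem periodicOp_apply {N : ℕ} (A : TailFamily N) (u : L2 N) :
    periodicOp A u =ᵐ[volume] fun k => ∑ j : Fin (N + 1), (A j k : ℂ) * avg j u k := by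
  have h : ∀ j : Fin (N + 1), mulL (A j) (avgL j u) =ᵐ[volume]
      fun k => (A j k : ℂ) * avg j u k := fun j => by
    filter_upwards [mulL_apply (A j) (avgL j u), avgL_apply j u] with k h1 h2
    rw [h1, h2]
  rw [periodicOp, sum_apply]
  have hs := Lp.coeFn_finsetSum Finset.univ (fun j : Fin (N + 1) => mulL (A j) (avgL j u))
  filter_upwards [hs, ae_all_iff.2 h] with k h1 h2
  simp only [ContinuousLinearMap.comp_apply]
  rw [h1, Finset.sum_apply]
  exact Finset.sum_congr rfl fun j _ => h2 j

/-! ### Continued fractions and Floquet–Bloch branches -/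

/-- The integral continued fractions `F_0(λ, 𝐤_0) = A_0(𝐤_0) - λ` and
`F_{j+1}(λ, 𝐤_{j+1}) = A_{j+1}(𝐤_{j+1}) + (∫_0^1 F_j(λ, k_{j+1}, 𝐤_{j+1})⁻¹ dk_{j+1})⁻¹`.
The values are meaningful for those `λ` that are allowed in `branch`. -/
def contFrac {N : ℕ} (A : TailFamily N) : Fin (N + 1) → ℝ → Cube N → ℝ :=
  Fin.induction (fun x k => A 0 k - x)
    (fun j Fj x k => A j.succ k + (∫ t : I, (Fj x (Function.update k j t))⁻¹)⁻¹)

theorem contFrac_zero {N : ℕ} (A : TailFamily N) (x : ℝ) (k : Cube N) :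
    contFrac A 0 x k = A 0 k - x := rfl

theorem contFrac_succ {N : ℕ} (A : TailFamily N) (j : Fin N) (x : ℝ) (k : Cube N) :
    contFrac A j.succ x k =
      A j.succ k + (∫ t : I, (contFrac A j.castSucc x (Function.update k j t))⁻¹)⁻¹ := rfl

/-- The Floquet–Bloch branch `λ_j(𝐤_j)`, as a set: the real zeros `x` of `F_j(·, 𝐤_j)` that lie in
none of the sets `λ_r([0,1]^{j-r}, 𝐤_j)`, `r < j`. -/
def branch {N : ℕ} (A : TailFamily N) (j : Fin (N + 1)) (k : Cube N) : Set ℝ :=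
  {x | contFrac A j x k = 0 ∧
    ∀ r : Fin (N + 1), r < j → ∀ k' : Cube N, SameTail j k' k → x ∉ branch A r k'}
termination_by j.val

/-- The spectral component `σ_j = λ_j([0,1]^{N-j})`. -/
def sigma {N : ℕ} (A : TailFamily N) (j : Fin (N + 1)) : Set ℝ :=
  ⋃ k : Cube N, branch A j k

/-- The non-overlap condition: for `j ≥ 1` the value `λ_j(𝐤_j)` lies in none of the sets
`λ_r([0,1]^{j-r}, 𝐤_j)`, `r < j`. -/
def NonOverlap {N : ℕ} (lam : TailFamily N) : Prop :=
  ∀ j r : Fin (N + 1), r < j → ∀ k k' : Cube N, SameTail j k' k → lam j k ≠ lam r k'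

/-- The functions `lam_j` are the Floquet–Bloch branches of the operator with components `A`. -/
def HasBranches {N : ℕ} (A lam : TailFamily N) : Prop :=
  ∀ (j : Fin (N + 1)) (k : Cube N), branch A j k = {lam j k}

end PeriodicDefects

end

open PeriodicDefects

namespace PeriodicDefects

open Set Filter Topology

variable {N : ℕ}

/-! ### Means over the unit interval -/

/-! Everything rests on the monotonicity of the continued fractions. The harmonic mean of a nowhere
vanishing continuous function on the unit interval is strictly increasing in that function, even
when the sign changes from negative to positive. Hence each `F_j` is strictly decreasing in `λ`
wherever it is meaningful, across gaps as well, and has at most one zero there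
(`strictAntiOn_contFrac`, `branch_subsingleton`).

The operator is reduced one variable at a time. When `F_0, …, F_{j-1}` vanish nowhere at `x`, there
is a profile `G` with `⟨G w⟩_{1,j} = w` such that the truncation `A_0 + … + A_j ⟨·⟩_{1,j} - x` sends
`G w` to `F_j w`, for every `w` depending on `𝐤_j` only (`exists_profile`). If `F_j` has no zero
either, the truncations are surjective by induction on `j`; for `j = N`, self-adjointness adds
injectivity, so `x` is not in the spectrum. Otherwise take the least `j` with `x ∈ σ_j`. For `j = N`
the profile is an eigenvector. For `j < N`, a function `w` concentrated near the zero of `F_j` with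
zero mean over `k_{j+1}` is annihilated by all higher averages, so `G w` is an approximate
eigenvector (`mem_spectrum_of_mem_sigma`).

By the intermediate value theorem a branch is a continuous function on an open set of parameters,
which gives countably many intervals. For the union of the `σ_j` with `j < N`, a branch defined
everywhere adds one compact interval, while each point of any other branch is joined to lower
components inside the union, so that no new interval is needed
(`exists_uIcc_subset_of_not_forall_nonempty`).

In the inverse problem `A_j` enters `F_j` additively, so `F_j(λ_j) = 0` can be solved for `A_j`,
uniquely, once the lower components are known. -/

theorem forall_pos_or_forall_neg {X : Type*} [TopologicalSpace X] [PreconnectedSpace X]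
    {f : X → ℝ} (hf : Continuous f) (h0 : ∀ t, f t ≠ 0) : (∀ t, 0 < f t) ∨ ∀ t, f t < 0 := by
  by_contra! h
  obtain ⟨⟨a, ha⟩, b, hb⟩ := h
  obtain ⟨c, hc⟩ := mem_range_of_exists_le_of_exists_ge hf ⟨a, ha⟩ ⟨b, hb⟩
  exact h0 c hc

theorem integrable_unitInterval {f : I → ℝ} (hf : Continuous f) : Integrable f :=
  hf.integrable_of_hasCompactSupport (HasCompactSupport.of_compactSpace f)

theorem integral_unitInterval_pos {f : I → ℝ} (hf : Continuous f) (h0 : ∀ t, 0 < f t) :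
    0 < ∫ t, f t := by
  obtain ⟨m, -, hm⟩ := isCompact_univ.exists_isMinOn univ_nonempty hf.continuousOn
  calc 0 < f m := h0 m
    _ = ∫ _ : I, f m := by simp
    _ ≤ ∫ t, f t := integral_mono (integrable_const _) (integrable_unitInterval hf)
        fun t => hm (mem_univ t)

theorem integral_unitInterval_lt {f g : I → ℝ} (hf : Continuous f) (hg : Continuous g)
    (h : ∀ t, f t < g t) : ∫ t, f t < ∫ t, g t := by
  have := integral_unitInterval_pos (hg.sub hf) fun t => sub_pos.2 (h t)
  rw [show (∫ t, (g - f) t) = (∫ t, g t) - ∫ t, f t from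
    integral_sub (integrable_unitInterval hg) (integrable_unitInterval hf)] at this
  linarith

theorem integral_inv_pos {f : I → ℝ} (hf : Continuous f) (h0 : ∀ t, 0 < f t) :
    0 < ∫ t, (f t)⁻¹ :=
  integral_unitInterval_pos (hf.inv₀ fun t => (h0 t).ne') fun t => inv_pos.2 (h0 t)

theorem integral_inv_neg {f : I → ℝ} (hf : Continuous f) (h0 : ∀ t, f t < 0) :
    ∫ t, (f t)⁻¹ < 0 := by
  have := integral_inv_pos hf.neg fun t => neg_pos.2 (h0 t)
  simp only [Pi.neg_apply, inv_neg, integral_neg] at this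
  linarith

theorem integral_inv_ne_zero {f : I → ℝ} (hf : Continuous f) (h0 : ∀ t, f t ≠ 0) :
    ∫ t, (f t)⁻¹ ≠ 0 := by
  rcases forall_pos_or_forall_neg hf h0 with h | h
  · exact (integral_inv_pos hf h).ne'
  · exact (integral_inv_neg hf h).ne

/-- The harmonic mean is strictly monotone. -/
theorem inv_integral_inv_lt {f g : I → ℝ} (hf : Continuous f) (hg : Continuous g)
    (hf0 : ∀ t, f t ≠ 0) (hg0 : ∀ t, g t ≠ 0) (h : ∀ t, f t < g t) :
    (∫ t, (f t)⁻¹)⁻¹ < (∫ t, (g t)⁻¹)⁻¹ := by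
  rcases forall_pos_or_forall_neg hf hf0 with hf1 | hf1 <;>
    rcases forall_pos_or_forall_neg hg hg0 with hg1 | hg1
  · refine inv_strictAnti₀ (integral_inv_pos hg hg1) ?_
    exact integral_unitInterval_lt (hg.inv₀ hg0) (hf.inv₀ hf0) fun t =>
      inv_strictAnti₀ (hf1 t) (h t)
  · exact absurd (h 0) (by linarith [hf1 0, hg1 0])
  · exact (inv_lt_zero.2 (integral_inv_neg hf hf1)).trans (inv_pos.2 (integral_inv_pos hg hg1))
  · refine (inv_lt_inv_of_neg (integral_inv_neg hf hf1) (integral_inv_neg hg hg1)).2 ?_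
    exact integral_unitInterval_lt (hg.inv₀ hg0) (hf.inv₀ hf0) fun t =>
      (inv_lt_inv_of_neg (hg1 t) (hf1 t)).2 (h t)

/-! ### Tails -/

theorem SameTail.refl (j : Fin (N + 1)) (k : Cube N) : SameTail j k k := fun _ _ => rfl

theorem SameTail.symm {j : Fin (N + 1)} {k k' : Cube N} (h : SameTail j k k') :
    SameTail j k' k := fun i hi => (h i hi).symm

theorem SameTail.trans {j : Fin (N + 1)} {k k' k'' : Cube N} (h : SameTail j k k')
    (h' : SameTail j k' k'') : SameTail j k k'' := fun i hi => (h i hi).trans (h' i hi)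

theorem SameTail.mono {i j : Fin (N + 1)} (hij : i ≤ j) {k k' : Cube N} (h : SameTail i k k') :
    SameTail j k k' := fun l hl => h l (le_trans (Fin.le_def.1 hij) hl)

theorem sameTail_update (j : Fin N) (k : Cube N) (t : I) :
    SameTail j.succ (Function.update k j t) k := fun i hi => by
  rw [Function.update_of_ne]
  rintro rfl
  simp at hi

theorem SameTail.update {j : Fin N} {k k' : Cube N} (h : SameTail j.succ k k') (t : I) :
    SameTail j.castSucc (Function.update k j t) (Function.update k' j t) := fun i hi => by
  by_cases hij : i = j
  · subst hij; simp
  · rw [Function.update_of_ne hij, Function.update_of_ne hij]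
    refine h i ?_
    have : i.val ≠ j.val := fun h => hij (Fin.ext h)
    simp only [Fin.val_castSucc, Fin.val_succ] at hi ⊢
    omega

theorem SameTail.update_self {j : Fin N} {k k' : Cube N} (h : SameTail j.succ k' k) :
    SameTail j.castSucc k' (Function.update k j (k' j)) := by
  simpa using h.update (k' j)

theorem sameTail_last (k k' : Cube N) : SameTail (Fin.last N) k k' := fun i hi => by
  simp only [Fin.val_last] at hi
  omega

/-- A function on the cube that depends on `𝐤_j` only. -/
def IsTail {β : Type*} (j : Fin (N + 1)) (f : Cube N → β) : Prop :=
  ∀ k k' : Cube N, SameTail j k k' → f k = f k'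

theorem IsTail.mono {β : Type*} {i j : Fin (N + 1)} (hij : i ≤ j) {f : Cube N → β}
    (h : IsTail j f) : IsTail i f := fun _ _ hk => h _ _ (hk.mono hij)

theorem isTail_zero {β : Type*} (f : Cube N → β) : IsTail 0 f := fun k k' h => by
  rw [funext fun i => h i (Nat.zero_le _)]

theorem TailFamily.isTail (A : TailFamily N) (j : Fin (N + 1)) : IsTail j (A j) :=
  fun _ _ h => A.dependsOn_tail j fun i hi => h i hi

theorem isTail_contFrac (A : TailFamily N) (j : Fin (N + 1)) (x : ℝ) :
    IsTail j (contFrac A j x) := by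
  induction j using Fin.induction with
  | zero => exact isTail_zero _
  | succ j ih =>
    intro k k' h
    rw [contFrac_succ, contFrac_succ, A.isTail j.succ k k' h]
    simp_rw [fun t => ih _ _ (h.update t)]

theorem branch_eq (A : TailFamily N) (j : Fin (N + 1)) (k : Cube N) :
    branch A j k = {x | contFrac A j x k = 0 ∧
      ∀ r : Fin (N + 1), r < j → ∀ k' : Cube N, SameTail j k' k → x ∉ branch A r k'} := by
  rw [branch]

theorem isTail_branch (A : TailFamily N) (j : Fin (N + 1)) : IsTail j (branch A j) := by
  intro k k' h
  rw [branch_eq, branch_eq]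
  ext x
  rw [mem_ofPred_eq, mem_ofPred_eq, isTail_contFrac A j x k k' h]
  refine and_congr_right fun _ => forall_congr' fun r => imp_congr_right fun _ =>
    forall_congr' fun k'' => ?_
  exact ⟨fun H h' => H (h'.trans h.symm), fun H h' => H (h'.trans h)⟩

/-! ### The domain of a continued fraction -/

/-- The set of all `(λ, 𝐤)` such that `λ` lies in none of the sets `λ_r([0,1]^{j-r}, 𝐤_j)` with
`r < j`; on this set the continued fraction `F_j` is meaningful. -/
def fracDomain (A : TailFamily N) (j : Fin (N + 1)) : Set (ℝ × Cube N) :=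
  {p | ∀ r : Fin (N + 1), r < j → ∀ k' : Cube N, SameTail j k' p.2 → p.1 ∉ branch A r k'}

theorem mem_branch (A : TailFamily N) (j : Fin (N + 1)) (k : Cube N) (x : ℝ) :
    x ∈ branch A j k ↔ contFrac A j x k = 0 ∧ (x, k) ∈ fracDomain A j := by
  rw [branch_eq]; rfl

theorem fracDomain_zero (A : TailFamily N) : fracDomain A 0 = univ :=
  eq_univ_of_forall fun _ r hr => absurd hr (Fin.not_lt_zero r)

/-- A point with the same `𝐤_{j+1}` as `k` has the same `𝐤_j` as some `update k j t`. This turns the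
recursive exclusion of branches into a non-vanishing condition on the previous fraction, the form
used in every induction on `j`. -/
theorem mem_fracDomain_succ (A : TailFamily N) (j : Fin N) (x : ℝ) (k : Cube N) :
    (x, k) ∈ fracDomain A j.succ ↔ ∀ t : I,
      (x, Function.update k j t) ∈ fracDomain A j.castSucc ∧
        contFrac A j.castSucc x (Function.update k j t) ≠ 0 := by
  constructor
  · intro h t
    have h1 : (x, Function.update k j t) ∈ fracDomain A j.castSucc := fun r hr k' hk' =>
      h r (hr.trans Fin.castSucc_lt_succ) k'
        ((hk'.mono Fin.castSucc_lt_succ.le).trans (sameTail_update j k t))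
    refine ⟨h1, fun h0 => ?_⟩
    exact h j.castSucc Fin.castSucc_lt_succ _ (sameTail_update j k t)
      ((mem_branch _ _ _ _).2 ⟨h0, h1⟩)
  · intro h r hr k' hk'
    rcases (Fin.le_castSucc_iff.2 hr).lt_or_eq with hr' | rfl
    · exact (h (k' j)).1 r hr' k' hk'.update_self
    · intro hb
      refine (h (k' j)).2 ?_
      rw [← isTail_contFrac A j.castSucc x _ _ hk'.update_self]
      exact ((mem_branch _ _ _ _).1 hb).1

/-- The tube lemma: projection along a compact factor is a closed map. -/
theorem isOpen_setOf_forall_of_compactSpace {X Y : Type*} [TopologicalSpace X] [TopologicalSpace Y]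
    [CompactSpace Y] {U : Set (X × Y)} (hU : IsOpen U) : IsOpen {x | ∀ y, (x, y) ∈ U} := by
  have h := isClosedMap_fst_of_compactSpace (X := X) (Y := Y) _ hU.isClosed_compl
  convert h.isOpen_compl using 1
  ext x
  simp

theorem continuous_integral_unitInterval {X : Type*} [TopologicalSpace X]
    [FirstCountableTopology X] [LocallyCompactSpace X] {f : X → I → ℝ}
    (hf : Continuous (Function.uncurry f)) : Continuous fun x => ∫ t, f x t := by
  simpa using continuous_parametric_integral_of_continuous (μ := volume) hf isCompact_univ

/-- The two claims need each other: continuity of `F_j` makes its non-vanishing set open, hence the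
next domain open by compactness of the interval. On that domain `F_j` has constant sign in the
integrated variable, so the mean of its inverse is non-zero and can be inverted continuously. -/
theorem isOpen_fracDomain_and_continuousOn (A : TailFamily N) (j : Fin (N + 1)) :
    IsOpen (fracDomain A j) ∧
      ContinuousOn (fun p : ℝ × Cube N => contFrac A j p.1 p.2) (fracDomain A j) := by
  induction j using Fin.induction with
  | zero =>
    rw [fracDomain_zero]
    refine ⟨isOpen_univ, Continuous.continuousOn ?_⟩
    simp only [contFrac_zero]
    fun_prop
  | succ j ih =>
    have hV := ih.2.isOpen_inter_preimage ih.1 (isOpen_compl_singleton (x := (0 : ℝ)))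
    set V := fracDomain A j.castSucc ∩
      (fun p : ℝ × Cube N => contFrac A j.castSucc p.1 p.2) ⁻¹' {0}ᶜ
    have hupd : Continuous fun q : (ℝ × Cube N) × I =>
        ((q.1.1, Function.update q.1.2 j q.2) : ℝ × Cube N) :=
      (continuous_fst.comp continuous_fst).prodMk
        ((continuous_snd.comp continuous_fst).update j continuous_snd)
    have hdom : fracDomain A j.succ =
        {p | ∀ t : I, (p, t) ∈ (fun q : (ℝ × Cube N) × I =>
          ((q.1.1, Function.update q.1.2 j q.2) : ℝ × Cube N)) ⁻¹' V} := by
      ext ⟨x, k⟩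
      rw [mem_fracDomain_succ]
      rfl
    have hopen : IsOpen (fracDomain A j.succ) := by
      rw [hdom]
      exact isOpen_setOf_forall_of_compactSpace (hV.preimage hupd)
    refine ⟨hopen, ?_⟩
    have : LocallyCompactSpace (fracDomain A j.succ) := hopen.locallyCompactSpace
    rw [continuousOn_iff_continuous_domRestrict]
    have hF : Continuous (Function.uncurry fun (p : fracDomain A j.succ) (t : I) =>
        (contFrac A j.castSucc p.1.1 (Function.update p.1.2 j t))⁻¹) := by
      refine Continuous.inv₀ ?_ fun q => ((mem_fracDomain_succ A j _ _).1 q.1.2 q.2).2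
      exact ih.2.comp_continuous
        (hupd.comp ((continuous_subtype_val.comp continuous_fst).prodMk continuous_snd))
        fun q => ((mem_fracDomain_succ A j _ _).1 q.1.2 q.2).1
    have hA : Continuous fun p : fracDomain A j.succ => A j.succ p.1.2 := by fun_prop
    refine hA.add ((continuous_integral_unitInterval hF).inv₀ fun p => ?_)
    refine integral_inv_ne_zero ?_ fun t => ((mem_fracDomain_succ A j _ _).1 p.2 t).2
    exact ih.2.comp_continuous
        (hupd.comp (continuous_const.prodMk continuous_id))
        fun q => ((mem_fracDomain_succ A j _ _).1 p.2 q).1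

theorem isOpen_fracDomain (A : TailFamily N) (j : Fin (N + 1)) : IsOpen (fracDomain A j) :=
  (isOpen_fracDomain_and_continuousOn A j).1

theorem continuousOn_contFrac (A : TailFamily N) (j : Fin (N + 1)) :
    ContinuousOn (fun p : ℝ × Cube N => contFrac A j p.1 p.2) (fracDomain A j) :=
  (isOpen_fracDomain_and_continuousOn A j).2

theorem continuous_contFrac_update (A : TailFamily N) (j : Fin N) {x : ℝ} {k : Cube N}
    (h : (x, k) ∈ fracDomain A j.succ) :
    Continuous fun t : I => contFrac A j.castSucc x (Function.update k j t) :=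
  (continuousOn_contFrac A j.castSucc).comp_continuous
    (f := fun t : I => ((x, Function.update k j t) : ℝ × Cube N))
    (continuous_const.prodMk (continuous_const.update j continuous_id))
    fun t => ((mem_fracDomain_succ A j _ _).1 h t).1

theorem contFrac_update_ne_zero (A : TailFamily N) (j : Fin N) {x : ℝ} {k : Cube N}
    (h : (x, k) ∈ fracDomain A j.succ) (t : I) :
    contFrac A j.castSucc x (Function.update k j t) ≠ 0 :=
  ((mem_fracDomain_succ A j _ _).1 h t).2

theorem integral_inv_contFrac_ne_zero (A : TailFamily N) (j : Fin N) {x : ℝ} {k : Cube N}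
    (h : (x, k) ∈ fracDomain A j.succ) :
    ∫ t : I, (contFrac A j.castSucc x (Function.update k j t))⁻¹ ≠ 0 :=
  integral_inv_ne_zero (continuous_contFrac_update A j h) (contFrac_update_ne_zero A j h)

/-- Strict monotonicity of the harmonic mean carries the property from `F_j` to `F_{j+1}`. The
domain in `λ` may be disconnected; comparing values of opposite sign covers the gaps. -/
theorem strictAntiOn_contFrac (A : TailFamily N) (j : Fin (N + 1)) (k : Cube N) :
    StrictAntiOn (fun x => contFrac A j x k) {x | (x, k) ∈ fracDomain A j} := by
  induction j using Fin.induction generalizing k with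
  | zero =>
    intro x _ y _ hxy
    simp only [contFrac_zero]
    linarith
  | succ j ih =>
    intro x hx y hy hxy
    simp only [contFrac_succ]
    have := inv_integral_inv_lt (continuous_contFrac_update A j hy)
      (continuous_contFrac_update A j hx) (contFrac_update_ne_zero A j hy)
      (contFrac_update_ne_zero A j hx) fun t => ih (Function.update k j t)
        ((mem_fracDomain_succ A j _ _).1 hx t).1 ((mem_fracDomain_succ A j _ _).1 hy t).1 hxy
    linarith

theorem branch_subsingleton (A : TailFamily N) (j : Fin (N + 1)) (k : Cube N) :
    (branch A j k).Subsingleton := by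
  intro x hx y hy
  rw [mem_branch] at hx hy
  exact (strictAntiOn_contFrac A j k).injOn hx.2 hy.2 (hx.1.trans hy.1.symm)

/-- The points `λ` at which `F_j(λ, ·)` is meaningful on the whole cube are those outside
`⋃ r < j, σ_r`. -/
theorem forall_mem_fracDomain_iff (A : TailFamily N) (j : Fin (N + 1)) (x : ℝ) :
    (∀ k, (x, k) ∈ fracDomain A j) ↔ ∀ r < j, x ∉ sigma A r := by
  simp only [sigma, mem_iUnion, not_exists]
  exact ⟨fun h r hr k => h k r hr k (SameTail.refl j k), fun h k r hr k' _ => h r hr k'⟩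

/-! ### Multiplication operators and averages -/

theorem mulL_mulL (a b : C(Cube N, ℝ)) (u : L2 N) : mulL a (mulL b u) = mulL (a * b) u := by
  apply Lp.ext
  filter_upwards [mulL_apply a (mulL b u), mulL_apply b u, mulL_apply (a * b) u] with k h1 h2 h3
  rw [h1, h2, h3, ContinuousMap.mul_apply, Complex.ofReal_mul, mul_assoc]

theorem mulL_eq_smul {c : ℝ} (a : C(Cube N, ℝ)) (ha : ∀ k, a k = c) (u : L2 N) :
    mulL a u = (c : ℂ) • u := by
  apply Lp.ext
  filter_upwards [mulL_apply a u, Lp.coeFn_smul (c : ℂ) u] with k h1 h2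
  rw [h1, h2, ha, Pi.smul_apply, smul_eq_mul]

theorem mulL_add_apply (a b : C(Cube N, ℝ)) (u : L2 N) :
    mulL (a + b) u = mulL a u + mulL b u := by
  apply Lp.ext
  filter_upwards [mulL_apply a u, mulL_apply b u, mulL_apply (a + b) u,
    Lp.coeFn_add (mulL a u) (mulL b u)] with k h1 h2 h3 h4
  rw [h4, h3, Pi.add_apply, h1, h2, ContinuousMap.add_apply, Complex.ofReal_add, add_mul]

theorem mulL_one_apply (u : L2 N) : mulL 1 u = u := by
  rw [mulL_eq_smul (c := 1) 1 (fun _ => rfl) u]; simp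

theorem merge_of_sameTail {j : Fin (N + 1)} {k k' : Cube N} (h : SameTail j k k')
    (s : {i : Fin N // i.val < j.val} → I) : merge j s k = merge j s k' := by
  funext i
  unfold merge
  split_ifs with hi
  · rfl
  · exact h i (not_lt.1 hi)

theorem sameTail_merge (j : Fin (N + 1)) (s : {i : Fin N // i.val < j.val} → I) (k : Cube N) :
    SameTail j (merge j s k) k := fun i hi => by
  unfold merge
  rw [dif_neg (not_lt.2 hi)]

theorem isTail_avg (j : Fin (N + 1)) (u : Cube N → ℂ) : IsTail j (avg j u) := fun k k' h => by
  unfold avg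
  simp_rw [merge_of_sameTail h]

theorem avg_mul_of_isTail {j : Fin (N + 1)} {v : Cube N → ℂ} (hv : IsTail j v) (u : Cube N → ℂ)
    (k : Cube N) : avg j (fun k => v k * u k) k = v k * avg j u k := by
  unfold avg
  simp_rw [hv _ _ (sameTail_merge j _ k)]
  exact integral_const_mul _ _

theorem avg_of_isTail {j : Fin (N + 1)} {v : Cube N → ℂ} (hv : IsTail j v) : avg j v = v := by
  funext k
  unfold avg
  simp_rw [hv _ _ (sameTail_merge j _ k)]
  simp

theorem avgL_zero (u : L2 N) : avgL 0 u = u := by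
  apply Lp.ext
  filter_upwards [avgL_apply 0 u] with k h1
  rw [h1, avg_of_isTail (isTail_zero _)]

theorem avgL_avgL_of_le {i j : Fin (N + 1)} (hij : i ≤ j) (u : L2 N) :
    avgL i (avgL j u) = avgL j u := by
  apply Lp.ext
  filter_upwards [avgL_apply i (avgL j u), avgL_apply j u, avg_congr i (avgL_apply j u)]
    with k h1 h2 h3
  rw [h1, h3, h2, avg_of_isTail ((isTail_avg j _).mono hij)]

theorem avgL_eq_self_of_le {i j : Fin (N + 1)} (hij : i ≤ j) {u : L2 N} (hu : avgL j u = u) :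
    avgL i u = u := by
  rw [← hu, avgL_avgL_of_le hij]

theorem norm_avgL_apply_le (j : Fin (N + 1)) (u : L2 N) : ‖avgL j u‖ ≤ ‖u‖ := by
  have : ‖(avgL j : L2 N →L[ℂ] L2 N)‖ ≤ 1 := LinearMap.mkContinuous_norm_le _ zero_le_one _
  simpa using (avgL j).le_of_opNorm_le this u

/-- Birkhoff–James orthogonality in an inner product space is orthogonality. -/
theorem inner_eq_zero_of_forall_norm_le {E : Type*} [NormedAddCommGroup E] [InnerProductSpace ℂ E]
    {x y : E} (h : ∀ c : ℂ, ‖x‖ ≤ ‖x + c • y‖) : inner ℂ x y = 0 := by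
  by_cases hy : y = 0
  · simp [hy]
  have hy' : (0 : ℝ) < ‖y‖ ^ 2 := by positivity
  set z : ℂ := inner ℂ x y with hz
  -- This coefficient minimises `‖x + c • y‖`.
  have key := h (-(starRingEnd ℂ z) / (‖y‖ ^ 2 : ℝ))
  have h2 : ‖x‖ ^ 2 ≤ ‖x + (-(starRingEnd ℂ z) / (‖y‖ ^ 2 : ℝ)) • y‖ ^ 2 := by gcongr
  rw [@norm_add_sq ℂ, inner_smul_right, norm_smul, ← hz] at h2
  have h3 : -(starRingEnd ℂ z) / ((‖y‖ ^ 2 : ℝ) : ℂ) * z = ((-(‖z‖ ^ 2 / ‖y‖ ^ 2) : ℝ) : ℂ) := by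
    have := Complex.conj_mul' z
    rw [div_mul_eq_mul_div, neg_mul, this]
    push_cast
    ring
  rw [h3] at h2
  simp only [norm_div, norm_neg, RCLike.norm_conj, Complex.norm_real, Real.norm_eq_abs,
    Complex.ofReal_re, RCLike.re_eq_complex_re, abs_of_pos hy'] at h2
  have h4 : (‖z‖ / ‖y‖ ^ 2 * ‖y‖) ^ 2 = ‖z‖ ^ 2 / ‖y‖ ^ 2 := by
    field_simp
  rw [h4] at h2
  have h5 : ‖z‖ ^ 2 / ‖y‖ ^ 2 ≤ 0 := by linarith
  have h6 : ‖z‖ ^ 2 ≤ 0 := by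
    by_contra! h7
    exact absurd h5 (not_le.2 (div_pos h7 hy'))
  have : ‖z‖ = 0 := by nlinarith [norm_nonneg z]
  simpa using this

/-- An idempotent of norm at most one is an orthogonal projection: for `v` in the kernel, `‖P u‖ =
‖P (P u + c v)‖ ≤ ‖P u + c v‖` for all `c`. -/
theorem isSelfAdjoint_avgL (j : Fin (N + 1)) : IsSelfAdjoint (avgL j : L2 N →L[ℂ] L2 N) := by
  rw [ContinuousLinearMap.isSelfAdjoint_iff_isSymmetric]
  have hid : IsIdempotentElem ((avgL j : L2 N →L[ℂ] L2 N) : L2 N →ₗ[ℂ] L2 N) :=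
    LinearMap.ext fun u => avgL_avgL_of_le le_rfl u
  rw [LinearMap.IsIdempotentElem.isSymmetric_iff_isOrtho_range_ker hid,
    Submodule.isOrtho_iff_inner_eq]
  rintro _ ⟨u, rfl⟩ v hv
  have hv' : avgL j v = 0 := hv
  refine inner_eq_zero_of_forall_norm_le fun c => ?_
  refine le_trans (le_of_eq ?_) (norm_avgL_apply_le j _)
  rw [map_add, map_smul, hv', smul_zero, add_zero]
  exact congrArg norm (avgL_avgL_of_le le_rfl u).symm

/-- The tower property, obtained by taking adjoints in `avgL_avgL_of_le` instead of applying Fubini.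
-/
theorem avgL_comp_avgL {i j : Fin (N + 1)} (hij : i ≤ j) :
    (avgL j : L2 N →L[ℂ] L2 N) * avgL i = avgL j := by
  have h : (avgL i : L2 N →L[ℂ] L2 N) * avgL j = avgL j :=
    ContinuousLinearMap.ext fun u => avgL_avgL_of_le hij u
  have h2 := congrArg star h
  rwa [star_mul, (isSelfAdjoint_avgL i).star_eq, (isSelfAdjoint_avgL j).star_eq] at h2

theorem avgL_avgL_of_ge {i j : Fin (N + 1)} (hij : i ≤ j) (u : L2 N) :
    avgL j (avgL i u) = avgL j u :=
  DFunLike.congr_fun (avgL_comp_avgL hij) u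

theorem isSelfAdjoint_mulL (a : C(Cube N, ℝ)) : IsSelfAdjoint (mulL a : L2 N →L[ℂ] L2 N) := by
  rw [ContinuousLinearMap.isSelfAdjoint_iff_isSymmetric]
  intro u v
  rw [L2.inner_def, L2.inner_def]
  refine integral_congr_ae ?_
  filter_upwards [mulL_apply a u, mulL_apply a v] with k h1 h2
  simp only [ContinuousLinearMap.coe_coe]
  rw [h1, h2]
  simp only [RCLike.inner_apply, map_mul, Complex.conj_ofReal]
  ring

theorem avgL_mulL {j : Fin (N + 1)} {a : C(Cube N, ℝ)} (ha : IsTail j a) (u : L2 N) :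
    avgL j (mulL a u) = mulL a (avgL j u) := by
  apply Lp.ext
  filter_upwards [avgL_apply j (mulL a u), avg_congr j (mulL_apply a u), mulL_apply a (avgL j u),
    avgL_apply j u] with k h1 h2 h3 h4
  rw [h1, h2, h3, h4, avg_mul_of_isTail (v := fun k => (a k : ℂ)) fun k k' h =>
    congrArg Complex.ofReal (ha k k' h)]

theorem isSelfAdjoint_periodicOp (A : TailFamily N) : IsSelfAdjoint (periodicOp A) := by
  unfold periodicOp
  refine isSelfAdjoint_sum _ fun j _ => ?_
  have hc : (avgL j : L2 N →L[ℂ] L2 N) * mulL (A j) = mulL (A j) * avgL j :=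
    ContinuousLinearMap.ext fun u => avgL_mulL (A.isTail j) u
  change IsSelfAdjoint (mulL (A j) * avgL j)
  rw [IsSelfAdjoint, star_mul, (isSelfAdjoint_mulL _).star_eq, (isSelfAdjoint_avgL j).star_eq, hc]

/-- The mean of a continuous function over the variable `k_{j+1}`. -/
noncomputable def coordMean (j : Fin N) (a : C(Cube N, ℝ)) : C(Cube N, ℝ) where
  toFun k := ∫ t : I, a (Function.update k j t)
  continuous_toFun := continuous_integral_unitInterval
    (a.continuous.comp (continuous_fst.update j continuous_snd))

theorem coordMean_apply (j : Fin N) (a : C(Cube N, ℝ)) (k : Cube N) :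
    coordMean j a k = ∫ t : I, a (Function.update k j t) := rfl

/-- Of the averaged variables `k_1, …, k_{j+1}` only the last is seen by `a`, and evaluation at one
coordinate preserves measure. -/
theorem avg_isTail_castSucc (j : Fin N) {a : C(Cube N, ℝ)} (ha : IsTail j.castSucc a)
    (k : Cube N) : avg j.succ (fun k => (a k : ℂ)) k = (coordMean j a k : ℂ) := by
  have hj : j.val < j.succ.val := by simp
  have h : ∀ s : {i : Fin N // i.val < j.succ.val} → I,
      a (merge j.succ s k) = a (Function.update k j (s ⟨j, hj⟩)) := fun s => by
    refine ha _ _ ?_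
    have := (sameTail_merge j.succ s k).update_self
    rwa [show merge j.succ s k j = s ⟨j, hj⟩ from dif_pos hj] at this
  unfold avg
  simp_rw [h, coordMean_apply]
  rw [integral_complex_ofReal]
  congr 1
  have hm := measurePreserving_eval
    (fun _ : {i : Fin N // i.val < j.succ.val} => (volume : Measure I)) ⟨j, hj⟩
  have hc : Continuous fun t : I => a (Function.update k j t) :=
    a.continuous.comp (continuous_const.update j continuous_id)
  rw [← hm.map_eq, integral_map hm.measurable.aemeasurable hc.aestronglyMeasurable]
  rfl

theorem avgL_succ_mulL (j : Fin N) {a : C(Cube N, ℝ)} (ha : IsTail j.castSucc a) {w : L2 N}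
    (hw : avgL j.succ w = w) : avgL j.succ (mulL a w) = mulL (coordMean j a) w := by
  have hw' : w =ᵐ[volume] avg j.succ w := by
    have := avgL_apply j.succ w
    rwa [hw] at this
  have h : mulL a w =ᵐ[volume] fun k => avg j.succ w k * (a k : ℂ) := by
    filter_upwards [mulL_apply a w, hw'] with k h1 h2
    rw [h1, ← h2, mul_comm]
  apply Lp.ext
  filter_upwards [avgL_apply j.succ (mulL a w), avg_congr j.succ h, mulL_apply (coordMean j a) w,
    hw'] with k h1 h2 h3 h4
  rw [h1, h2, h3, avg_mul_of_isTail (isTail_avg _ _), avg_isTail_castSucc j ha, ← h4, mul_comm]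

/-! ### The spectrum -/

/-- `F_j(λ, ·)` as a continuous function, for `λ` outside `⋃ r < j, σ_r`. -/
noncomputable def contFracMap (A : TailFamily N) (j : Fin (N + 1)) (x : ℝ)
    (h : ∀ k, (x, k) ∈ fracDomain A j) : C(Cube N, ℝ) where
  toFun k := contFrac A j x k
  continuous_toFun := (continuousOn_contFrac A j).comp_continuous
    (f := fun k => ((x, k) : ℝ × Cube N)) (by fun_prop) h

/-- The pointwise inverse of a continuous function without zeros. -/
noncomputable def invMap (f : C(Cube N, ℝ)) (h : ∀ k, f k ≠ 0) : C(Cube N, ℝ) where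
  toFun k := (f k)⁻¹
  continuous_toFun := f.continuous.inv₀ h

/-- The truncated operator `u ↦ A_0 u + A_1 ⟨u⟩_1 + … + A_j ⟨u⟩_{1,j} - x u`. -/
noncomputable def truncOp (A : TailFamily N) (j : Fin (N + 1)) (x : ℝ) : L2 N →L[ℂ] L2 N :=
  ∑ i ∈ Finset.Iic j, (mulL (A i)).comp (avgL i) - (x : ℂ) • ContinuousLinearMap.id ℂ (L2 N)

theorem truncOp_zero (A : TailFamily N) (x : ℝ) (u : L2 N) :
    truncOp A 0 x u = mulL (A 0) u - (x : ℂ) • u := by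
  have : Finset.Iic (0 : Fin (N + 1)) = {0} := by
    ext i; simp
  simp [truncOp, this, avgL_zero, -Complex.coe_smul]

theorem truncOp_succ (A : TailFamily N) (j : Fin N) (x : ℝ) (u : L2 N) :
    truncOp A j.succ x u = truncOp A j.castSucc x u + mulL (A j.succ) (avgL j.succ u) := by
  have : Finset.Iic j.succ = insert j.succ (Finset.Iic j.castSucc) := by
    ext i
    simp only [Finset.mem_Iic, Finset.mem_insert, Fin.le_castSucc_iff]
    exact le_iff_eq_or_lt
  simp only [truncOp, this]
  rw [Finset.sum_insert (by simp)]
  simp only [sub_apply, add_apply, ContinuousLinearMap.comp_apply]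
  abel

theorem truncOp_last (A : TailFamily N) (x : ℝ) (u : L2 N) :
    truncOp A (Fin.last N) x u = periodicOp A u - (x : ℂ) • u := by
  have : Finset.Iic (Fin.last N) = Finset.univ := by
    ext i; simp [Fin.le_last]
  simp [truncOp, periodicOp, this, -Complex.coe_smul]

theorem fracDomain_castSucc_of_succ {A : TailFamily N} {j : Fin N} {x : ℝ}
    (h : ∀ k, (x, k) ∈ fracDomain A j.succ) (k : Cube N) :
    (x, k) ∈ fracDomain A j.castSucc := by
  simpa using ((mem_fracDomain_succ A j x k).1 (h k) (k j)).1

theorem contFrac_castSucc_ne_zero {A : TailFamily N} {j : Fin N} {x : ℝ}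
    (h : ∀ k, (x, k) ∈ fracDomain A j.succ) (k : Cube N) : contFrac A j.castSucc x k ≠ 0 := by
  simpa using ((mem_fracDomain_succ A j x k).1 (h k) (k j)).2

theorem mulL_comm (a b : C(Cube N, ℝ)) (u : L2 N) : mulL a (mulL b u) = mulL b (mulL a u) := by
  rw [mulL_mulL, mulL_mulL, mul_comm]

theorem mulL_mulL_invMap (a : C(Cube N, ℝ)) (h : ∀ k, a k ≠ 0) (u : L2 N) :
    mulL a (mulL (invMap a h) u) = u := by
  rw [mulL_mulL, show a * invMap a h = 1 from ContinuousMap.ext fun k => mul_inv_cancel₀ (h k),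
    mulL_one_apply]

/-- The Floquet–Bloch profile: `truncOp A j x` acts on `G w`, for `w` depending on `𝐤_j` only, as
multiplication of `w` by `F_j(x, ·)`. -/
theorem exists_profile (A : TailFamily N) (j : Fin (N + 1)) (x : ℝ)
    (h : ∀ k, (x, k) ∈ fracDomain A j) :
    ∃ G : C(Cube N, ℝ), ∀ w : L2 N, avgL j w = w →
      avgL j (mulL G w) = w ∧ truncOp A j x (mulL G w) = mulL (contFracMap A j x h) w := by
  induction j using Fin.induction with
  | zero =>
    refine ⟨1, fun w _ => ?_⟩
    rw [mulL_one_apply, avgL_zero, truncOp_zero]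
    refine ⟨rfl, ?_⟩
    have : contFracMap A 0 x h = A 0 + ContinuousMap.const _ (-x) :=
      ContinuousMap.ext fun k => sub_eq_add_neg _ _
    rw [this, mulL_add_apply, mulL_eq_smul (c := -x) (ContinuousMap.const _ (-x)) fun _ => rfl]
    push_cast
    rw [neg_smul, sub_eq_add_neg]
  | succ j ih =>
    have h' := fracDomain_castSucc_of_succ h
    obtain ⟨G, hG⟩ := ih h'
    set F := contFracMap A j.castSucc x h' with hF
    have hF0 : ∀ k, F k ≠ 0 := contFrac_castSucc_ne_zero h
    have hFt : IsTail j.castSucc (invMap F hF0) := fun k k' hk =>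
      congrArg (·⁻¹) (isTail_contFrac A j.castSucc x k k' hk)
    set c := coordMean j (invMap F hF0) with hc
    have hc0 : ∀ k, c k ≠ 0 := fun k => integral_inv_contFrac_ne_zero A j (h k)
    have hct : IsTail j.castSucc (invMap c hc0) := fun k k' hk => by
      refine congrArg (·⁻¹) (integral_congr_ae (Eventually.of_forall fun t => ?_))
      exact hFt _ _ ((hk.mono Fin.castSucc_lt_succ.le).update t)
    -- The factor `F_j⁻¹` cancels the `F_j` produced by the previous truncation, and `c⁻¹ =
    -- ⟨F_j⁻¹⟩⁻¹` normalises the new average to `w`. What remains is `c⁻¹ w + A_{j+1} w = F_{j+1}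
    -- w`.
    refine ⟨G * (invMap F hF0 * invMap c hc0), fun w hw => ?_⟩
    have hw' := avgL_eq_self_of_le Fin.castSucc_lt_succ.le hw
    set v := mulL (invMap F hF0) (mulL (invMap c hc0) w) with hv
    have hvt : avgL j.castSucc v = v := by
      rw [hv, avgL_mulL hFt, avgL_mulL hct, hw']
    have h1 : mulL (G * (invMap F hF0 * invMap c hc0)) w = mulL G v := by
      rw [hv, mulL_mulL, mulL_mulL, mul_assoc]
    have h2 : avgL j.succ (mulL G v) = w := by
      rw [← avgL_avgL_of_ge Fin.castSucc_lt_succ.le, (hG v hvt).1, hv, mulL_comm,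
        avgL_mulL, avgL_succ_mulL j hFt hw, mulL_comm, mulL_mulL_invMap]
      intro k k' hk
      refine congrArg (·⁻¹) (integral_congr_ae (Eventually.of_forall fun t => ?_))
      exact hFt _ _ (hk.update t)
    rw [h1]
    refine ⟨h2, ?_⟩
    rw [truncOp_succ, h2, (hG v hvt).2, hv, mulL_mulL_invMap, ← mulL_add_apply, add_comm]
    rfl

/-- A solution `u` for the previous truncation leaves the error `A_{j+1} ⟨u⟩_{1,j+1}`. It depends on
`𝐤_{j+1}` only, so dividing it by `F_{j+1}` and applying the profile yields an exact correction. -/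
theorem exists_truncOp_eq (A : TailFamily N) (j : Fin (N + 1)) (x : ℝ)
    (h : ∀ k, (x, k) ∈ fracDomain A j) (h0 : ∀ k, contFrac A j x k ≠ 0) (f : L2 N) :
    ∃ u, truncOp A j x u = f := by
  induction j using Fin.induction with
  | zero =>
    obtain ⟨G, hG⟩ := exists_profile A 0 x h
    have h0' : ∀ k, contFracMap A 0 x h k ≠ 0 := h0
    refine ⟨mulL G (mulL (invMap (contFracMap A 0 x h) h0') f), ?_⟩
    rw [(hG _ (avgL_zero _)).2, mulL_mulL_invMap]
  | succ j ih =>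
    obtain ⟨u, hu⟩ := ih (fracDomain_castSucc_of_succ h) (contFrac_castSucc_ne_zero h)
    obtain ⟨G, hG⟩ := exists_profile A j.succ x h
    have h0' : ∀ k, contFracMap A j.succ x h k ≠ 0 := h0
    set R := invMap (contFracMap A j.succ x h) h0' with hRdef
    have hR : IsTail j.succ R := fun k k' hk =>
      congrArg (·⁻¹) (isTail_contFrac A j.succ x k k' hk)
    set w := mulL R (mulL (A j.succ) (avgL j.succ u)) with hw
    have hwt : avgL j.succ w = w := by
      rw [hw, avgL_mulL hR, avgL_mulL (A.isTail j.succ), avgL_avgL_of_le le_rfl]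
    refine ⟨u - mulL G w, ?_⟩
    rw [map_sub, (hG w hwt).2, truncOp_succ, hu, hw, hRdef, mulL_mulL_invMap, add_sub_cancel_right]

theorem spectrum_periodicOp_real {A : TailFamily N} {z : ℂ} (hz : z ∈ spectrum ℂ (periodicOp A)) :
    z = z.re :=
  (isSelfAdjoint_periodicOp A).mem_spectrum_eq_re hz

theorem mem_spectrum_iff_not_isUnit (A : TailFamily N) (x : ℝ) :
    (x : ℂ) ∈ spectrum ℂ (periodicOp A) ↔ ¬ IsUnit (truncOp A (Fin.last N) x) := by
  rw [spectrum.mem_iff, not_iff_not, ← IsUnit.neg_iff]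
  congr! 1
  ext1 u
  rw [truncOp_last]
  simp [Algebra.algebraMap_eq_smul_one, -Complex.coe_smul]

theorem isSelfAdjoint_truncOp_last (A : TailFamily N) (x : ℝ) :
    IsSelfAdjoint (truncOp A (Fin.last N) x) := by
  have : truncOp A (Fin.last N) x = periodicOp A - algebraMap ℂ _ (x : ℂ) := by
    ext1 u
    rw [truncOp_last]
    simp [Algebra.algebraMap_eq_smul_one, -Complex.coe_smul]
  rw [this]
  exact (isSelfAdjoint_periodicOp A).sub (IsSelfAdjoint.algebraMap _ (Complex.conj_ofReal x))

theorem not_mem_spectrum_of_forall_not_mem_sigma {A : TailFamily N} {x : ℝ}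
    (h : ∀ j, x ∉ sigma A j) : (x : ℂ) ∉ spectrum ℂ (periodicOp A) := by
  rw [mem_spectrum_iff_not_isUnit, not_not, ContinuousLinearMap.isUnit_iff_bijective]
  have hdom := (forall_mem_fracDomain_iff A (Fin.last N) x).2 fun r _ => h r
  have hsurj : Function.Surjective (truncOp A (Fin.last N) x) :=
    exists_truncOp_eq A (Fin.last N) x hdom fun k h0 =>
      h (Fin.last N) (mem_iUnion.2 ⟨k, (mem_branch _ _ _ _).2 ⟨h0, hdom k⟩⟩)
  refine ⟨?_, hsurj⟩
  -- The kernel of a symmetric operator is orthogonal to its range, which here is the whole space.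
  rw [injective_iff_map_eq_zero]
  intro u hu
  obtain ⟨v, hv⟩ := hsurj u
  have hsymm := (ContinuousLinearMap.isSelfAdjoint_iff_isSymmetric.1
    (isSelfAdjoint_truncOp_last A x)) u v
  simp only [ContinuousLinearMap.coe_coe] at hsymm
  rw [hu, hv, inner_zero_left] at hsymm
  exact inner_self_eq_zero.1 hsymm.symm

/-! ### Branch points lie in the spectrum: eigenvectors and approximate eigenvectors. -/

instance : (volume : Measure I).IsOpenPosMeasure where
  open_pos U hU hne := by
    obtain ⟨V, hV, rfl⟩ := isOpen_induced_iff.1 hU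
    obtain ⟨x, hx⟩ := hne
    -- The point `x` may be an endpoint, so the open set is moved into the interior `(0,1)`.
    have hx' : (x : ℝ) ∈ closure (Ioo (0 : ℝ) 1) := by
      rw [closure_Ioo (by norm_num)]; exact x.2
    have hne' : (V ∩ Ioo (0 : ℝ) 1).Nonempty := mem_closure_iff.1 hx' V hV hx
    have hpos := (hV.inter isOpen_Ioo).measure_pos (volume : Measure ℝ) hne'
    have himg : Subtype.val '' ((↑) ⁻¹' V : Set I) = V ∩ Icc (0 : ℝ) 1 := by
      rw [Subtype.image_preimage_coe, inter_comm]
    have : volume ((↑) ⁻¹' V : Set I) = volume (V ∩ Icc (0 : ℝ) 1) := by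
      rw [Measure.Subtype.volume_def, comap_subtype_coe_apply measurableSet_Icc, himg]
    change volume ((↑) ⁻¹' V : Set I) ≠ 0
    rw [this]
    exact (hpos.trans_le (measure_mono (by gcongr; exact Ioo_subset_Icc_self))).ne'

instance : (volume : Measure (Cube N)).IsOpenPosMeasure :=
  inferInstanceAs (Measure.pi fun _ : Fin N => (volume : Measure I)).IsOpenPosMeasure

/-- The constant function `1`. -/
noncomputable def oneL2 (N : ℕ) : L2 N := (memLp_const (1 : ℂ)).toLp (fun _ : Cube N => (1 : ℂ))

theorem oneL2_apply : oneL2 N =ᵐ[volume] fun _ => (1 : ℂ) := MemLp.coeFn_toLp _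

theorem avgL_oneL2 (j : Fin (N + 1)) : avgL j (oneL2 N) = oneL2 N := by
  apply Lp.ext
  filter_upwards [avgL_apply j (oneL2 N), avg_congr j oneL2_apply, oneL2_apply] with k h1 h2 h3
  rw [h1, h2, h3, avg_of_isTail fun _ _ _ => rfl]

theorem mulL_oneL2_apply (a : C(Cube N, ℝ)) : mulL a (oneL2 N) =ᵐ[volume] fun k => (a k : ℂ) := by
  filter_upwards [mulL_apply a (oneL2 N), oneL2_apply] with k h1 h2
  rw [h1, h2, mul_one]

theorem mulL_oneL2_ne_zero {a : C(Cube N, ℝ)} {k : Cube N} (hk : a k ≠ 0) :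
    mulL a (oneL2 N) ≠ 0 := by
  intro h
  have h1 : (fun k => (a k : ℂ)) =ᵐ[volume] fun _ => (0 : ℂ) := by
    have := mulL_oneL2_apply a
    rw [h] at this
    exact this.symm.trans (Lp.coeFn_zero _ _ _)
  have h2 := (Continuous.ae_eq_iff_eq volume (by fun_prop) (by fun_prop)).1 h1
  exact hk (Complex.ofReal_eq_zero.1 (congrFun h2 k))

theorem oneL2_ne_zero : oneL2 N ≠ 0 := by
  have := mulL_oneL2_ne_zero (a := (1 : C(Cube N, ℝ))) (k := 0) one_ne_zero
  rwa [mulL_one_apply] at this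

theorem hasEigenvalue_of_mem_sigma_last {A : TailFamily N} {x : ℝ}
    (hx : x ∈ sigma A (Fin.last N)) :
    Module.End.HasEigenvalue (periodicOp A : L2 N →ₗ[ℂ] L2 N) (x : ℂ) := by
  obtain ⟨k₀, hk₀⟩ := mem_iUnion.1 hx
  rw [mem_branch] at hk₀
  have hdom : ∀ k, (x, k) ∈ fracDomain A (Fin.last N) := fun k r hr k' _ =>
    hk₀.2 r hr k' (sameTail_last _ _)
  obtain ⟨G, hG⟩ := exists_profile A (Fin.last N) x hdom
  obtain ⟨h1, h2⟩ := hG _ (avgL_oneL2 _)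
  refine Module.End.hasEigenvalue_of_hasEigenvector (x := mulL G (oneL2 N))
    ⟨Module.End.mem_eigenspace_iff.2 ?_, fun h => ?_⟩
  -- The tail `𝐤_N` is empty, so `F_N(x, ·)` is constant and one zero makes it vanish identically.
  · rw [mulL_eq_smul (c := 0) (contFracMap A _ x hdom) fun k =>
      (isTail_contFrac A _ x k k₀ (sameTail_last _ _)).trans hk₀.1, truncOp_last] at h2
    simpa [sub_eq_zero] using h2
  · rw [h, map_zero] at h1
    exact oneL2_ne_zero h1.symm

/-- Near a zero of a continuous function `F` of `𝐤_j` there are functions of `𝐤_j` with vanishing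
mean over `k_{j+1}`. -/
theorem exists_localized (j : Fin N) {F : C(Cube N, ℝ)} (hF : IsTail j.castSucc F) {k₀ : Cube N}
    (hk₀ : F k₀ = 0) {ε : ℝ} (hε : 0 < ε) :
    ∃ w : L2 N, w ≠ 0 ∧ avgL j.castSucc w = w ∧ avgL j.succ w = 0 ∧ ‖mulL F w‖ ≤ ε * ‖w‖ := by
  -- A bump supported where `|F| ≤ ε`. With `a`, `b` the means of `φ` and `φ τ` over `k_{j+1}`, the
  -- function `φ (τ a - b)` has mean `b a - a b = 0`.
  set φ : C(Cube N, ℝ) := ⟨fun k => max 0 (ε - |F k|), by fun_prop⟩ with hφ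
  have hφt : IsTail j.castSucc φ := fun k k' h => by simp only [hφ, ContinuousMap.coe_mk, hF k k' h]
  set τ : C(Cube N, ℝ) := ⟨fun k => (k j : ℝ), by fun_prop⟩ with hτ
  have hτt : IsTail j.castSucc τ := fun k k' h => congrArg Subtype.val (h j le_rfl)
  set a := coordMean j φ
  set b := coordMean j (φ * τ)
  have hmean : ∀ {f : C(Cube N, ℝ)}, IsTail j.castSucc f → IsTail j.succ (coordMean j f) :=
    fun hf k k' h => integral_congr_ae (Eventually.of_forall fun t => hf _ _ (h.update t))
  have hat : IsTail j.succ a := hmean hφt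
  have hφτt : IsTail j.castSucc (φ * τ) := fun k k' h => by
    rw [ContinuousMap.mul_apply, ContinuousMap.mul_apply, hφt k k' h, hτt k k' h]
  have hbt : IsTail j.succ b := hmean hφτt
  set ω : C(Cube N, ℝ) := φ * (τ * a - b) with hω
  have hle : j.castSucc ≤ j.succ := Fin.castSucc_lt_succ.le
  have hωt : IsTail j.castSucc ω := fun k k' h => by
    simp only [hω, ContinuousMap.mul_apply, ContinuousMap.sub_apply]
    rw [hφt k k' h, hτt k k' h, hat.mono hle k k' h, hbt.mono hle k k' h]
  have hint : ∀ (f : C(Cube N, ℝ)) (k : Cube N),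
      Continuous fun t : I => f (Function.update k j t) := fun f k =>
    f.continuous.comp (continuous_const.update j continuous_id)
  have hω0 : coordMean j ω = 0 := by
    ext k
    have h1 : ∀ t : I, ω (Function.update k j t) =
        (φ * τ) (Function.update k j t) * a k - φ (Function.update k j t) * b k := fun t => by
      simp only [hω, ContinuousMap.mul_apply, ContinuousMap.sub_apply]
      rw [hat _ _ (sameTail_update j k t), hbt _ _ (sameTail_update j k t)]
      ring
    rw [coordMean_apply]
    simp_rw [h1]
    rw [integral_sub ((integrable_unitInterval (hint _ k)).mul_const _)
      ((integrable_unitInterval (hint _ k)).mul_const _), integral_mul_const, integral_mul_const]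
    change b k * a k - a k * b k = 0
    ring
  have hωne : ∃ k, ω k ≠ 0 := by
    by_contra! h
    have hφ0 : 0 < φ k₀ := by simp [hφ, hk₀, hε]
    have ha : 0 < a k₀ := by
      refine (hint φ k₀).integral_pos_of_hasCompactSupport_nonneg_nonzero (x := k₀ j)
        (HasCompactSupport.of_compactSpace _) (fun t => le_max_left _ _) ?_
      rw [Function.update_eq_self]
      exact hφ0.ne'
    have hev : ∀ᶠ t in 𝓝 (k₀ j), 0 < φ (Function.update k₀ j t) := by
      refine (hint φ k₀).continuousAt.eventually (lt_mem_nhds ?_)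
      beta_reduce
      rwa [Function.update_eq_self]
    -- If `ω` vanished, the coordinate `t` would be constant on a neighbourhood of `k₀ j`, which is
    -- impossible because the interval has no isolated points.
    have hall : ∀ t : I, 0 < φ (Function.update k₀ j t) → (t : ℝ) = b k₀ / a k₀ := fun t ht => by
      have := h (Function.update k₀ j t)
      simp only [hω, ContinuousMap.mul_apply, ContinuousMap.sub_apply] at this
      rw [hat _ _ (sameTail_update j k₀ t), hbt _ _ (sameTail_update j k₀ t)] at this
      have h3 := (mul_eq_zero.1 this).resolve_left ht.ne'
      rw [eq_div_iff ha.ne']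
      simpa [hτ, sub_eq_zero] using h3
    have hself := hall (k₀ j) hev.self_of_nhds
    have : ∀ᶠ t in 𝓝[≠] (k₀ j), False := by
      filter_upwards [hev.filter_mono nhdsWithin_le_nhds, self_mem_nhdsWithin] with t ht hne
      exact hne (Subtype.ext ((hall t ht).trans hself.symm))
    exact this.exists.elim fun _ h => h
  obtain ⟨k₁, hk₁⟩ := hωne
  refine ⟨mulL ω (oneL2 N), mulL_oneL2_ne_zero hk₁, ?_, ?_, ?_⟩
  · rw [avgL_mulL hωt, avgL_oneL2]
  · rw [avgL_succ_mulL j hωt (avgL_oneL2 _), hω0, mulL_eq_smul (c := 0) _ fun _ => rfl]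
    simp
  · apply Lp.norm_le_mul_norm_of_ae_le_mul
    filter_upwards [mulL_apply F (mulL ω (oneL2 N)), mulL_oneL2_apply ω] with k h1 h2
    rw [h1, h2, norm_mul, Complex.norm_real, Real.norm_eq_abs]
    by_cases hk : |F k| ≤ ε
    · gcongr
    · have : φ k = 0 := max_eq_left (by linarith)
      simp [hω, this]

theorem truncOp_last_of_avgL_eq_zero (A : TailFamily N) (x : ℝ) (j : Fin N) {u : L2 N}
    (hu : avgL j.succ u = 0) : truncOp A (Fin.last N) x u = truncOp A j.castSucc x u := by
  have h : ∀ i : Fin (N + 1), j.castSucc < i → avgL i u = 0 := fun i hi => by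
    rw [← avgL_avgL_of_ge (Fin.castSucc_lt_iff_succ_le.1 hi), hu, map_zero]
  simp only [truncOp, sub_apply, sum_apply, ContinuousLinearMap.comp_apply]
  congr 1
  refine (Finset.sum_subset (Finset.Iic_subset_Iic.2 (Fin.le_last _)) fun i _ hi => ?_).symm
  rw [h i (not_le.1 fun hle => hi (Finset.mem_Iic.2 hle)), map_zero]

/-- Passing to the least `j` makes `F_j(x, ·)` meaningful on the whole cube. For `j < N`, an inverse
of `𝒜 - x` would bound `G w` by a small multiple of `w`, although `‖w‖ = ‖⟨G w⟩_{1,j}‖ ≤ ‖G w‖`. -/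
theorem mem_spectrum_of_mem_sigma {A : TailFamily N} {x : ℝ} {j : Fin (N + 1)}
    (hx : x ∈ sigma A j) : (x : ℂ) ∈ spectrum ℂ (periodicOp A) := by
  induction j using WellFoundedLT.induction with
  | ind j ih =>
  by_cases hex : ∃ r < j, x ∈ sigma A r
  · obtain ⟨r, hr, hxr⟩ := hex
    exact ih r hr hxr
  push Not at hex
  have hdom := (forall_mem_fracDomain_iff A j x).2 hex
  obtain ⟨k₀, hk₀⟩ := mem_iUnion.1 hx
  rw [mem_branch] at hk₀
  induction j using Fin.lastCases with
  | last =>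
    rw [mem_spectrum_iff_not_isUnit]
    intro hu
    obtain ⟨v, hv⟩ := (hasEigenvalue_of_mem_sigma_last hx).exists_hasEigenvector
    refine hv.2 ((ContinuousLinearMap.isUnit_iff_bijective.1 hu).1 ?_)
    rw [map_zero, truncOp_last, sub_eq_zero]
    exact hv.apply_eq_smul
  | cast j =>
    rw [mem_spectrum_iff_not_isUnit]
    intro hu
    obtain ⟨S, hS⟩ := hu.exists_left_inv
    obtain ⟨G, hG⟩ := exists_profile A j.castSucc x hdom
    -- Any `ε` with `‖S‖ ε < 1` would do; the `+ 1` avoids division by zero.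
    have hε : 0 < (2 * (‖S‖ + 1))⁻¹ := by positivity
    obtain ⟨w, hw0, hw1, hw2, hw3⟩ := exists_localized j
      (F := contFracMap A j.castSucc x hdom) (isTail_contFrac A j.castSucc x) hk₀.1 hε
    obtain ⟨h1, h2⟩ := hG w hw1
    have h3 : avgL j.succ (mulL G w) = 0 := by
      rw [← avgL_avgL_of_ge Fin.castSucc_lt_succ.le, h1, hw2]
    rw [← truncOp_last_of_avgL_eq_zero A x j h3] at h2
    have h4 : mulL G w = S (mulL (contFracMap A j.castSucc x hdom) w) := by
      rw [← h2]
      exact (DFunLike.congr_fun hS (mulL G w)).symm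
    have h5 : ‖w‖ ≤ ‖S‖ * ((2 * (‖S‖ + 1))⁻¹ * ‖w‖) :=
      calc ‖w‖ = ‖avgL j.castSucc (mulL G w)‖ := by rw [h1]
        _ ≤ ‖mulL G w‖ := norm_avgL_apply_le _ _
        _ ≤ ‖S‖ * ‖mulL (contFracMap A j.castSucc x hdom) w‖ := by
          rw [h4]; exact S.le_opNorm _
        _ ≤ _ := by gcongr
    have hw : 0 < ‖w‖ := norm_pos_iff.2 hw0
    have h6 : ‖S‖ * ((2 * (‖S‖ + 1))⁻¹ * ‖w‖) < ‖w‖ := by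
      rw [← mul_assoc, ← div_eq_mul_inv]
      refine mul_lt_of_lt_one_left hw ?_
      rw [div_lt_one (by positivity)]
      linarith [norm_nonneg S]
    exact absurd h5 (not_le.2 h6)

theorem spectrum_periodicOp (A : TailFamily N) :
    spectrum ℂ (periodicOp A) = (fun x : ℝ => (x : ℂ)) '' ⋃ j : Fin (N + 1), sigma A j := by
  ext z
  constructor
  · intro hz
    have hre := spectrum_periodicOp_real hz
    refine ⟨z.re, ?_, hre.symm⟩
    by_contra h
    simp only [mem_iUnion, not_exists] at h
    rw [hre] at hz
    exact not_mem_spectrum_of_forall_not_mem_sigma h hz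
  · rintro ⟨x, hx, rfl⟩
    obtain ⟨j, hj⟩ := mem_iUnion.1 hx
    exact mem_spectrum_of_mem_sigma hj

/-! ### Dependence of the branches on the parameters -/

theorem exists_mem_branch_of_sign_change {A : TailFamily N} {j : Fin (N + 1)} {k : Cube N}
    {a b : ℝ} (hab : a ≤ b) (hdom : ∀ y ∈ Icc a b, (y, k) ∈ fracDomain A j)
    (ha : 0 < contFrac A j a k) (hb : contFrac A j b k < 0) : ∃ y ∈ Icc a b, y ∈ branch A j k := by
  have hc : ContinuousOn (fun y => contFrac A j y k) (Icc a b) :=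
    (continuousOn_contFrac A j).comp (f := fun y => ((y, k) : ℝ × Cube N)) (by fun_prop) hdom
  obtain ⟨y, hy, h0⟩ := intermediate_value_Icc' hab hc ⟨hb.le, ha.le⟩
  exact ⟨y, hy, (mem_branch _ _ _ _).2 ⟨h0, hdom y hy⟩⟩

theorem continuousAt_contFrac {A : TailFamily N} {j : Fin (N + 1)} {k : Cube N} {x : ℝ}
    (h : (x, k) ∈ fracDomain A j) : ContinuousAt (fun k => contFrac A j x k) k := by
  have h1 := (continuousOn_contFrac A j).continuousAt ((isOpen_fracDomain A j).mem_nhds h)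
  exact h1.comp (f := fun k => ((x, k) : ℝ × Cube N)) (by fun_prop)

/-- By strict monotonicity `F_j` has opposite signs at `x - d` and `x + d`. The signs persist for
nearby parameters and force a zero in between, which gives both openness of the branch domain and
continuity of the branch. -/
theorem eventually_exists_mem_branch {A : TailFamily N} {j : Fin (N + 1)} {k₀ : Cube N} {x : ℝ}
    (hx : x ∈ branch A j k₀) {ε : ℝ} (hε : 0 < ε) :
    ∀ᶠ k in 𝓝 k₀, ∃ y ∈ branch A j k, |y - x| < ε := by
  rw [mem_branch] at hx
  obtain ⟨δ, hδ, hball⟩ := Metric.isOpen_iff.1 (isOpen_fracDomain A j) _ hx.2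
  obtain ⟨d, hd, hdlt⟩ := exists_between (lt_min hδ hε)
  have hdom : ∀ y ∈ Icc (x - d) (x + d), ∀ k ∈ Metric.ball k₀ δ, (y, k) ∈ fracDomain A j := by
    intro y hy k hk
    refine hball ?_
    rw [← ball_prod_same]
    refine ⟨?_, hk⟩
    rw [Metric.mem_ball, Real.dist_eq, abs_lt]
    have := hdlt.trans_le (min_le_left _ _)
    constructor <;> linarith [hy.1, hy.2]
  have hk₀ := Metric.mem_ball_self (x := k₀) hδ
  have hl : x - d ∈ Icc (x - d) (x + d) := ⟨le_rfl, by linarith⟩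
  have hr : x + d ∈ Icc (x - d) (x + d) := ⟨by linarith, le_rfl⟩
  have hanti := strictAntiOn_contFrac A j k₀
  have h1 : 0 < contFrac A j (x - d) k₀ := by
    rw [← hx.1]
    exact hanti (hdom _ hl _ hk₀) hx.2 (by linarith)
  have h2 : contFrac A j (x + d) k₀ < 0 := by
    rw [← hx.1]
    exact hanti hx.2 (hdom _ hr _ hk₀) (by linarith)
  filter_upwards [Metric.ball_mem_nhds k₀ hδ,
    (continuousAt_contFrac (hdom _ hl _ hk₀)).eventually (lt_mem_nhds h1),
    (continuousAt_contFrac (hdom _ hr _ hk₀)).eventually (gt_mem_nhds h2)] with k hk hk1 hk2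
  obtain ⟨y, hy, hyb⟩ := exists_mem_branch_of_sign_change (hl.2)
    (fun y hy => hdom y hy k hk) hk1 hk2
  refine ⟨y, hyb, (abs_le.2 ⟨?_, ?_⟩).trans_lt (hdlt.trans_le (min_le_right _ _))⟩ <;>
    linarith [hy.1, hy.2]

/-- The parameters at which the branch `λ_j` exists. -/
def branchDomain (A : TailFamily N) (j : Fin (N + 1)) : Set (Cube N) :=
  {k | (branch A j k).Nonempty}

open Classical in
/-- The branch `λ_j` as a function, with value `0` where the branch does not exist. -/
noncomputable def branchFun (A : TailFamily N) (j : Fin (N + 1)) (k : Cube N) : ℝ :=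
  if h : (branch A j k).Nonempty then h.some else 0

theorem branchFun_mem {A : TailFamily N} {j : Fin (N + 1)} {k : Cube N}
    (h : k ∈ branchDomain A j) : branchFun A j k ∈ branch A j k := by
  have h' : (branch A j k).Nonempty := h
  rw [branchFun, dif_pos h']
  exact h'.some_mem

theorem eq_branchFun {A : TailFamily N} {j : Fin (N + 1)} {k : Cube N} {x : ℝ}
    (h : x ∈ branch A j k) : x = branchFun A j k :=
  branch_subsingleton A j k h (branchFun_mem ⟨x, h⟩)

theorem isOpen_branchDomain (A : TailFamily N) (j : Fin (N + 1)) : IsOpen (branchDomain A j) := by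
  rw [isOpen_iff_mem_nhds]
  rintro k ⟨x, hx⟩
  filter_upwards [eventually_exists_mem_branch hx one_pos] with k' ⟨y, hy, _⟩
  exact ⟨y, hy⟩

theorem continuousOn_branchFun (A : TailFamily N) (j : Fin (N + 1)) :
    ContinuousOn (branchFun A j) (branchDomain A j) := by
  intro k hk
  refine ContinuousAt.continuousWithinAt (Metric.tendsto_nhds.2 fun ε hε => ?_)
  filter_upwards [eventually_exists_mem_branch (branchFun_mem hk) hε] with k' ⟨y, hy, hlt⟩
  rwa [Real.dist_eq, ← eq_branchFun hy]

theorem sigma_eq_image (A : TailFamily N) (j : Fin (N + 1)) :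
    sigma A j = branchFun A j '' branchDomain A j := by
  ext x
  rw [sigma, mem_iUnion]
  constructor
  · rintro ⟨k, hk⟩
    exact ⟨k, ⟨x, hk⟩, (eq_branchFun hk).symm⟩
  · rintro ⟨k, hk, rfl⟩
    exact ⟨k, branchFun_mem hk⟩

/-! ### Interval structure of a single spectral component. -/

theorem isPreconnected_ball_unitInterval (x : I) (ε : ℝ) : IsPreconnected (Metric.ball x ε) := by
  rw [← Topology.IsInducing.subtypeVal.isPreconnected_image]
  have : Subtype.val '' Metric.ball x ε = Icc (0 : ℝ) 1 ∩ Metric.ball (x : ℝ) ε := by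
    ext y
    constructor
    · rintro ⟨z, hz, rfl⟩
      exact ⟨z.2, hz⟩
    · rintro ⟨hy, hyb⟩
      exact ⟨⟨y, hy⟩, hyb, rfl⟩
  rw [this]
  exact ((convex_Icc 0 1).inter (convex_ball _ _)).isPreconnected

instance : LocallyConnectedSpace (Cube N) := by
  refine locallyConnectedSpace_of_connected_bases (fun k ε => Metric.ball k ε)
    (fun _ ε => 0 < ε) (fun k => Metric.nhds_basis_ball) fun k ε hε => ?_
  rw [ball_pi k hε]
  exact isPreconnected_univ_pi fun i => isPreconnected_ball_unitInterval _ _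

/-- The components of the open branch domain are open because the cube is locally connected, and
countably many cover it by second countability. The continuous branch maps each onto an interval. -/
theorem sigma_eq_iUnion_ordConnected (A : TailFamily N) (j : Fin (N + 1)) :
    ∃ J : ℕ → Set ℝ, (∀ n, (J n).OrdConnected) ∧ sigma A j = ⋃ n, J n := by
  rcases isEmpty_or_nonempty (branchDomain A j) with hD | hD
  · refine ⟨fun _ => ∅, fun _ => ordConnected_empty, ?_⟩
    rw [sigma_eq_image, isEmpty_coe_sort.1 hD]
    simp
  obtain ⟨T, hT, hTu⟩ := TopologicalSpace.isOpen_iUnion_countable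
    (fun k : branchDomain A j => connectedComponentIn (branchDomain A j) (k : Cube N))
    fun k => (isOpen_branchDomain A j).connectedComponentIn
  obtain ⟨g, hg⟩ := countable_iff_exists_subset_range.1 hT
  refine ⟨fun n => branchFun A j '' connectedComponentIn (branchDomain A j) (g n), fun n => ?_, ?_⟩
  · exact (isPreconnected_connectedComponentIn.image _ ((continuousOn_branchFun A j).mono
      (connectedComponentIn_subset _ _))).ordConnected
  · rw [sigma_eq_image, ← image_iUnion]
    congr 1
    refine Subset.antisymm (fun k hk => ?_)
      (iUnion_subset fun n => connectedComponentIn_subset _ _)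
    have hk' : k ∈ ⋃ k : branchDomain A j,
        connectedComponentIn (branchDomain A j) (k : Cube N) :=
      mem_iUnion.2 ⟨⟨k, hk⟩, mem_connectedComponentIn hk⟩
    rw [← hTu] at hk'
    obtain ⟨l, hl, hkl⟩ := mem_iUnion₂.1 hk'
    obtain ⟨n, rfl⟩ := hg hl
    exact mem_iUnion.2 ⟨n, hkl⟩

theorem isCompact_isConnected_sigma {A : TailFamily N} {j : Fin (N + 1)}
    (h : ∀ k, (branch A j k).Nonempty) : IsCompact (sigma A j) ∧ IsConnected (sigma A j) := by
  have hD : branchDomain A j = univ := eq_univ_of_forall h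
  have hc := continuousOn_branchFun A j
  rw [sigma_eq_image]
  rw [hD] at hc ⊢
  exact ⟨isCompact_univ.image_of_continuousOn hc, isConnected_univ.image _ hc⟩

theorem sigma_eq_Icc {A : TailFamily N} {j : Fin (N + 1)}
    (h : ∀ k, (branch A j k).Nonempty) : ∃ a b : ℝ, a ≤ b ∧ sigma A j = Icc a b := by
  obtain ⟨hc, hconn⟩ := isCompact_isConnected_sigma h
  have := eq_Icc_of_connected_compact hconn hc
  refine ⟨_, _, ?_, this⟩
  rw [← nonempty_Icc, ← this]
  exact hconn.nonempty

/-! ### Unions of spectral components -/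

/-- The union of the spectral components `σ_r`, `r < j`. -/
def sigmaBelow (A : TailFamily N) (j : Fin (N + 1)) : Set ℝ := {x | ∃ r < j, x ∈ sigma A r}

theorem notMem_sigmaBelow {A : TailFamily N} {j : Fin (N + 1)} {x : ℝ} :
    x ∉ sigmaBelow A j ↔ ∀ k, (x, k) ∈ fracDomain A j := by
  rw [forall_mem_fracDomain_iff, sigmaBelow]
  simp

/-- The complement is the set of `x` whose whole slice lies in the open domain of `F_j`, and the
cube is compact. -/
theorem isClosed_sigmaBelow (A : TailFamily N) (j : Fin (N + 1)) : IsClosed (sigmaBelow A j) := by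
  rw [← isOpen_compl_iff]
  convert isOpen_setOf_forall_of_compactSpace (isOpen_fracDomain A j) using 1
  ext x
  exact notMem_sigmaBelow

theorem abs_le_of_mem_sigma {A : TailFamily N} {j : Fin (N + 1)} {x : ℝ} (hx : x ∈ sigma A j) :
    |x| ≤ ‖periodicOp A‖ * ‖(1 : L2 N →L[ℂ] L2 N)‖ := by
  have := spectrum.norm_le_norm_mul_of_mem (mem_spectrum_of_mem_sigma hx)
  rwa [Complex.norm_real, Real.norm_eq_abs] at this

theorem isCompact_sigmaBelow (A : TailFamily N) (j : Fin (N + 1)) :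
    IsCompact (sigmaBelow A j) := by
  refine Metric.isCompact_of_isClosed_isBounded (isClosed_sigmaBelow A j) ?_
  refine (Metric.isBounded_closedBall
    (x := (0 : ℝ)) (r := ‖periodicOp A‖ * ‖(1 : L2 N →L[ℂ] L2 N)‖)).subset ?_
  rintro x ⟨r, _, hr⟩
  simpa using abs_le_of_mem_sigma hr

theorem sigmaBelow_succ (A : TailFamily N) (j : Fin N) :
    sigmaBelow A j.succ = sigmaBelow A j.castSucc ∪ sigma A j.castSucc := by
  ext x
  simp only [sigmaBelow, mem_ofPred_eq, mem_union, ← Fin.le_castSucc_iff, le_iff_lt_or_eq]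
  constructor
  · rintro ⟨r, hr | rfl, hx⟩
    exacts [.inl ⟨r, hr, hx⟩, .inr hx]
  · rintro (⟨r, hr, hx⟩ | hx)
    exacts [⟨r, .inl hr, hx⟩, ⟨_, .inr rfl, hx⟩]

/-- Between `x` and the nearest point of `S` below it there is a gap of `T`; if `S` has no point
below `x`, any point below all of `T` serves. -/
theorem exists_le_notMem_of_not_uIcc_subset {S T : Set ℝ} (hS : IsCompact S) (hST : S ⊆ T)
    (hT : BddBelow T) (x : ℝ) (h : ∀ y ∈ S, ¬ uIcc x y ⊆ T) :
    ∃ a ≤ x, a ∉ T ∧ ∀ y ∈ Icc a x, y ∉ S := by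
  by_cases hne : (S ∩ Iic x).Nonempty
  · obtain ⟨m, hm, hmax⟩ := (hS.inter_right isClosed_Iic).exists_isGreatest hne
    have := h m hm.1
    rw [uIcc_of_ge hm.2, not_subset] at this
    obtain ⟨a, ha, haT⟩ := this
    refine ⟨a, ha.2, haT, fun y hy hyS => haT (hST ?_)⟩
    have : y = a := le_antisymm ((hmax ⟨hyS, hy.2⟩).trans ha.1) hy.1
    rwa [← this]
  · obtain ⟨m, hm⟩ := hT
    refine ⟨min x (m - 1), min_le_left _ _, fun hmem => ?_, fun y hy hyS => hne ⟨y, hyS, hy.2⟩⟩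
    linarith [hm hmem, min_le_right x (m - 1)]

theorem exists_ge_notMem_of_not_uIcc_subset {S T : Set ℝ} (hS : IsCompact S) (hST : S ⊆ T)
    (hT : BddAbove T) (x : ℝ) (h : ∀ y ∈ S, ¬ uIcc x y ⊆ T) :
    ∃ b ≥ x, b ∉ T ∧ ∀ y ∈ Icc x b, y ∉ S := by
  by_cases hne : (S ∩ Ici x).Nonempty
  · obtain ⟨m, hm, hmin⟩ := (hS.inter_right isClosed_Ici).exists_isLeast hne
    have := h m hm.1
    rw [uIcc_of_le hm.2, not_subset] at this
    obtain ⟨b, hb, hbT⟩ := this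
    refine ⟨b, hb.1, hbT, fun y hy hyS => hbT (hST ?_)⟩
    have : y = b := le_antisymm hy.2 (hb.2.trans (hmin ⟨hyS, hy.1⟩))
    rwa [← this]
  · obtain ⟨m, hm⟩ := hT
    refine ⟨max x (m + 1), le_max_left _ _, fun hmem => ?_, fun y hy hyS => hne ⟨y, hyS, hy.1⟩⟩
    linarith [hm hmem, le_max_right x (m + 1)]

/-- If the branch `λ_j` does not exist everywhere, every point of `σ_j` is joined to
`⋃ r < j, σ_r` inside `⋃ r ≤ j, σ_r`. -/
theorem exists_uIcc_subset_of_not_forall_nonempty {A : TailFamily N} {j : Fin N}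
    (hfull : ¬ ∀ k, (branch A j.castSucc k).Nonempty) {x : ℝ} (hx : x ∈ sigma A j.castSucc) :
    ∃ y ∈ sigmaBelow A j.castSucc, uIcc x y ⊆ sigmaBelow A j.succ := by
  by_contra! h
  have hST : sigmaBelow A j.castSucc ⊆ sigmaBelow A j.succ := by
    rw [sigmaBelow_succ]; exact subset_union_left
  have hxT : x ∈ sigmaBelow A j.succ := by
    rw [sigmaBelow_succ]; exact Or.inr hx
  have hS := isCompact_sigmaBelow A j.castSucc
  have hT := isCompact_sigmaBelow A j.succ
  obtain ⟨a, hax, haT, ha⟩ := exists_le_notMem_of_not_uIcc_subset hS hST hT.bddBelow x h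
  obtain ⟨b, hbx, hbT, hb⟩ := exists_ge_notMem_of_not_uIcc_subset hS hST hT.bddAbove x h
  have hdom : ∀ y ∈ Icc a b, ∀ k, (y, k) ∈ fracDomain A j.castSucc := fun y hy => by
    rw [← notMem_sigmaBelow]
    rcases le_total y x with hyx | hxy
    · exact ha y ⟨hy.1, hyx⟩
    · exact hb y ⟨hxy, hy.2⟩
  have hab := hax.trans hbx
  have hda := hdom a ⟨le_rfl, hab⟩
  have hdb := hdom b ⟨hab, le_rfl⟩
  obtain ⟨k₀, hk₀⟩ := mem_iUnion.1 hx
  rw [mem_branch] at hk₀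
  have hax' : a < x := lt_of_le_of_ne hax fun h => haT (h ▸ hxT)
  have hxb' : x < b := lt_of_le_of_ne hbx fun h => hbT (h ▸ hxT)
  have hanti := strictAntiOn_contFrac A j.castSucc k₀
  -- Since `a` lies outside `⋃ r ≤ j, σ_r`, `F_j(a, ·)` has no zero on the connected cube; its sign
  -- is read off at `k₀`, where `F_j(x, k₀) = 0` and `a < x`. With the opposite sign at `b`, every
  -- `k` gets a zero, contradicting `hfull`.
  have hpos : ∀ k, 0 < contFracMap A j.castSucc a hda k := by
    refine (forall_pos_or_forall_neg (ContinuousMap.continuous _)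
      (contFrac_castSucc_ne_zero (notMem_sigmaBelow.1 haT))).resolve_right fun hneg => ?_
    have h1 : contFrac A j.castSucc a k₀ < 0 := hneg k₀
    have h2 := hanti (hda k₀) hk₀.2 hax'
    simp only [hk₀.1] at h2
    linarith
  have hneg : ∀ k, contFracMap A j.castSucc b hdb k < 0 := by
    refine (forall_pos_or_forall_neg (ContinuousMap.continuous _)
      (contFrac_castSucc_ne_zero (notMem_sigmaBelow.1 hbT))).resolve_left fun hpos => ?_
    have h1 : 0 < contFrac A j.castSucc b k₀ := hpos k₀
    have h2 := hanti hk₀.2 (hdb k₀) hxb'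
    simp only [hk₀.1] at h2
    linarith
  refine hfull fun k => ?_
  obtain ⟨y, _, hy⟩ := exists_mem_branch_of_sign_change hab (fun y hy => hdom y hy k)
    (hpos k) (hneg k)
  exact ⟨y, hy⟩

/-- The `p i` with `i < j` are base points, one for each possible interval; later values of `p` are
irrelevant. Only a branch defined everywhere needs a new base point, an endpoint of its interval. -/
theorem exists_uIcc_subset_sigmaBelow (A : TailFamily N) (j : Fin (N + 1)) :
    ∃ p : ℕ → ℝ, ∀ x ∈ sigmaBelow A j, ∃ i < j.val, uIcc x (p i) ⊆ sigmaBelow A j := by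
  induction j using Fin.induction with
  | zero => exact ⟨fun _ => 0, fun x ⟨r, hr, _⟩ => absurd hr (Fin.not_lt_zero r)⟩
  | succ j ih =>
    obtain ⟨p, hp⟩ := ih
    have hST : sigmaBelow A j.castSucc ⊆ sigmaBelow A j.succ := by
      rw [sigmaBelow_succ]; exact subset_union_left
    have hlt : ∀ i, i < j.castSucc.val → i < j.succ.val := fun i hi =>
      hi.trans Fin.castSucc_lt_succ
    by_cases hfull : ∀ k, (branch A j.castSucc k).Nonempty
    · obtain ⟨a, b, hab, hσ⟩ := sigma_eq_Icc hfull
      refine ⟨Function.update p j.val a, fun x hx => ?_⟩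
      rw [sigmaBelow_succ] at hx
      rcases hx with hx | hx
      · obtain ⟨i, hi, hsub⟩ := hp x hx
        refine ⟨i, hlt i hi, ?_⟩
        rw [Function.update_of_ne (by simpa using hi.ne)]
        exact hsub.trans hST
      · refine ⟨j.val, Nat.lt_succ_self _, ?_⟩
        rw [Function.update_self, sigmaBelow_succ]
        rw [hσ] at hx ⊢
        exact (ordConnected_Icc.uIcc_subset hx ⟨le_rfl, hab⟩).trans subset_union_right
    · refine ⟨p, fun x hx => ?_⟩
      rw [sigmaBelow_succ] at hx
      rcases hx with hx | hx
      · obtain ⟨i, hi, hsub⟩ := hp x hx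
        exact ⟨i, hlt i hi, hsub.trans hST⟩
      · obtain ⟨y, hy, hsub⟩ := exists_uIcc_subset_of_not_forall_nonempty hfull hx
        obtain ⟨i, hi, hsub'⟩ := hp y hy
        exact ⟨i, hlt i hi, uIcc_subset_uIcc_union_uIcc.trans
          (union_subset hsub (hsub'.trans hST))⟩

theorem ordConnected_setOf_uIcc_subset (T : Set ℝ) (p : ℝ) :
    {x | uIcc x p ⊆ T}.OrdConnected := by
  refine ⟨fun x hx y hy z hz w hw => ?_⟩
  rcases mem_uIcc.1 hw with ⟨h1, h2⟩ | ⟨h1, h2⟩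
  · exact hx (mem_uIcc.2 (.inl ⟨hz.1.trans h1, h2⟩))
  · exact hy (mem_uIcc.2 (.inr ⟨h1, h2.trans hz.2⟩))

theorem iUnion_sigma_castSucc_eq_iUnion (A : TailFamily N) :
    ∃ J : Fin N → Set ℝ, (∀ i, (J i).OrdConnected ∧ IsCompact (J i)) ∧
      (⋃ j : Fin N, sigma A j.castSucc) = ⋃ i, J i := by
  have hbelow : (⋃ j : Fin N, sigma A j.castSucc) = sigmaBelow A (Fin.last N) := by
    ext x
    rw [mem_iUnion]
    constructor
    · rintro ⟨j, hj⟩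
      exact ⟨_, Fin.castSucc_lt_last j, hj⟩
    · rintro ⟨r, hr, hx⟩
      exact ⟨r.castPred hr.ne, hx⟩
  rw [hbelow]
  set T := sigmaBelow A (Fin.last N)
  have hT : IsCompact T := isCompact_sigmaBelow A _
  obtain ⟨p, hp⟩ := exists_uIcc_subset_sigmaBelow A (Fin.last N)
  -- Closures supply compactness without leaving the closed set `T`; the set is empty if `p i ∉ T`.
  have hsub : ∀ i : Fin N, closure {x | uIcc x (p i) ⊆ T} ⊆ T := fun i =>
    closure_minimal (fun x hx => hx left_mem_uIcc) hT.isClosed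
  refine ⟨fun i => closure {x | uIcc x (p i) ⊆ T}, fun i => ⟨?_, ?_⟩, ?_⟩
  · exact (ordConnected_setOf_uIcc_subset T (p i)).isPreconnected.closure.ordConnected
  · exact hT.of_isClosed_subset isClosed_closure (hsub i)
  · refine Subset.antisymm (fun x hx => ?_) (iUnion_subset hsub)
    obtain ⟨i, hi, hxi⟩ := hp x hx
    exact mem_iUnion.2 ⟨⟨i, hi⟩, subset_closure hxi⟩

theorem sigma_last_subsingleton (A : TailFamily N) : (sigma A (Fin.last N)).Subsingleton := by
  intro x hx y hy
  obtain ⟨k, hk⟩ := mem_iUnion.1 hx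
  obtain ⟨k', hk'⟩ := mem_iUnion.1 hy
  rw [isTail_branch A _ k' k (sameTail_last _ _)] at hk'
  exact branch_subsingleton A _ k hk hk'

/-! ### The inverse problem -/

theorem contFrac_congr {A A' : TailFamily N} (j : Fin (N + 1)) (h : ∀ i ≤ j, A i = A' i) :
    contFrac A j = contFrac A' j := by
  induction j using Fin.induction with
  | zero =>
    funext x k
    rw [contFrac_zero, contFrac_zero, h 0 le_rfl]
  | succ j ih =>
    funext x k
    rw [contFrac_succ, contFrac_succ, h j.succ le_rfl,
      ih fun i hi => h i (hi.trans Fin.castSucc_lt_succ.le)]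

theorem branch_congr {A A' : TailFamily N} (j : Fin (N + 1)) (h : ∀ i ≤ j, A i = A' i) :
    branch A j = branch A' j := by
  induction j using WellFoundedLT.induction with
  | ind j ih =>
    have h' : ∀ r < j, branch A r = branch A' r := fun r hr => ih r hr fun i hi =>
      h i (hi.trans hr.le)
    funext k
    rw [branch_eq, branch_eq]
    ext x
    rw [mem_ofPred_eq, mem_ofPred_eq, contFrac_congr j h]
    refine and_congr_right fun _ => forall_congr' fun r => forall_congr' fun hr => ?_
    rw [h' r hr]

theorem mem_fracDomain_of_branch_eq {A lam : TailFamily N} (hlam : NonOverlap lam)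
    (j : Fin (N + 1)) (h : ∀ r < j, ∀ k, branch A r k = {lam r k}) (k : Cube N) :
    (lam j k, k) ∈ fracDomain A j := by
  intro r hr k' hk'
  rw [h r hr k']
  exact hlam j r hr k k' hk'

theorem branch_eq_singleton {A : TailFamily N} {j : Fin (N + 1)} {k : Cube N} {x : ℝ}
    (h0 : contFrac A j x k = 0) (hdom : (x, k) ∈ fracDomain A j) : branch A j k = {x} :=
  (branch_subsingleton A j k).eq_singleton_of_mem ((mem_branch _ _ _ _).2 ⟨h0, hdom⟩)

theorem coeff_zero_of_branch_eq {A lam : TailFamily N} (h : ∀ k, branch A 0 k = {lam 0 k})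
    (k : Cube N) : A 0 k = lam 0 k := by
  have : lam 0 k ∈ branch A 0 k := by rw [h k]; rfl
  have h0 := ((mem_branch _ _ _ _).1 this).1
  rw [contFrac_zero] at h0
  linarith

theorem coeff_succ_of_branch_eq {A lam : TailFamily N} (j : Fin N)
    (h : ∀ k, branch A j.succ k = {lam j.succ k}) (k : Cube N) :
    A j.succ k =
      -(∫ t : I, (contFrac A j.castSucc (lam j.succ k) (Function.update k j t))⁻¹)⁻¹ := by
  have : lam j.succ k ∈ branch A j.succ k := by rw [h k]; rfl
  have h0 := ((mem_branch _ _ _ _).1 this).1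
  rw [contFrac_succ] at h0
  linarith

/-- The lower components determine the previous fraction, and the vanishing of the next one at `λ_j`
then determines `A_j`. -/
theorem HasBranches.unique {A A' lam : TailFamily N} (h : HasBranches A lam)
    (h' : HasBranches A' lam) : A' = A := by
  refine TailFamily.ext (funext fun j => ?_)
  induction j using WellFoundedLT.induction with
  | ind j ih =>
    refine ContinuousMap.ext fun k => ?_
    induction j using Fin.cases with
    | zero => rw [coeff_zero_of_branch_eq (h 0), coeff_zero_of_branch_eq (h' 0)]
    | succ j =>
      rw [coeff_succ_of_branch_eq j (h j.succ), coeff_succ_of_branch_eq j (h' j.succ),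
        contFrac_congr j.castSucc fun i hi => ih i (hi.trans_lt Fin.castSucc_lt_succ)]

theorem dependsOn_of_isTail {j : Fin (N + 1)} {f : Cube N → ℝ} (h : IsTail j f) :
    DependsOn f {i : Fin N | j.val ≤ i.val} := fun _ _ hk => h _ _ hk

/-- Replace one component of a family. -/
def TailFamily.update (A : TailFamily N) (j : Fin (N + 1)) (f : C(Cube N, ℝ)) (hf : IsTail j f) :
    TailFamily N where
  toFun := Function.update A.toFun j f
  dependsOn_tail i := by
    by_cases hij : i = j
    · subst hij
      rw [Function.update_self]
      exact dependsOn_of_isTail hf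
    · rw [Function.update_of_ne hij]
      exact A.dependsOn_tail i

theorem TailFamily.update_apply_self (A : TailFamily N) (j : Fin (N + 1)) (f : C(Cube N, ℝ))
    (hf : IsTail j f) : A.update j f hf j = f := Function.update_self _ _ _

theorem TailFamily.update_apply_of_ne (A : TailFamily N) {i j : Fin (N + 1)} (f : C(Cube N, ℝ))
    (hf : IsTail j f) (hij : i ≠ j) : A.update j f hf i = A i := Function.update_of_ne hij _ _

theorem exists_branch_eq_singleton {lam : TailFamily N} (hlam : NonOverlap lam)
    (j : Fin (N + 1)) : ∃ A : TailFamily N, ∀ r ≤ j, ∀ k, branch A r k = {lam r k} := by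
  induction j using Fin.induction with
  | zero =>
    -- Only the component `A_0 = λ_0` matters here; the others are placeholders to be replaced.
    refine ⟨lam, fun r hr k => ?_⟩
    obtain rfl := Fin.le_zero_iff.1 hr
    refine branch_eq_singleton ?_ ?_
    · rw [contFrac_zero, sub_self]
    · rw [fracDomain_zero]; trivial
  | succ j ih =>
    obtain ⟨A, hA⟩ := ih
    have hdom := mem_fracDomain_of_branch_eq (A := A) hlam j.succ fun r hr =>
      hA r (Fin.le_castSucc_iff.2 hr)
    set F : Cube N → ℝ := fun k => contFrac A j.succ (lam j.succ k) k with hF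
    have hFc : Continuous F := (continuousOn_contFrac A j.succ).comp_continuous
      (f := fun k => ((lam j.succ k, k) : ℝ × Cube N)) (by fun_prop) hdom
    set f : C(Cube N, ℝ) := ⟨fun k => A j.succ k - F k, by fun_prop⟩ with hf
    have hft : IsTail j.succ f := fun k k' hk => by
      simp only [hf, hF, ContinuousMap.coe_mk]
      rw [A.isTail j.succ k k' hk, lam.isTail j.succ k k' hk, isTail_contFrac A j.succ _ k k' hk]
    set A' := A.update j.succ f hft
    have hAA' : ∀ i ≤ j.castSucc, A' i = A i := fun i hi =>
      A.update_apply_of_ne f hft (hi.trans_lt Fin.castSucc_lt_succ).ne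
    have hlow : ∀ r < j.succ, ∀ k, branch A' r k = {lam r k} := fun r hr k => by
      have hr' := Fin.le_castSucc_iff.2 hr
      rw [branch_congr r fun i hi => hAA' i (hi.trans hr'), hA r hr']
    refine ⟨A', fun r hr k => ?_⟩
    rcases hr.lt_or_eq with hr | rfl
    · exact hlow r hr k
    refine branch_eq_singleton ?_ (mem_fracDomain_of_branch_eq hlam _ hlow k)
    have h1 : A' j.succ k = A j.succ k - F k := by
      rw [A.update_apply_self]; rfl
    rw [contFrac_succ, contFrac_congr j.castSucc hAA', h1]
    simp only [hF, contFrac_succ]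
    ring

theorem exists_hasBranches {lam : TailFamily N} (hlam : NonOverlap lam) :
    ∃ A : TailFamily N, HasBranches A lam := by
  obtain ⟨A, hA⟩ := exists_branch_eq_singleton hlam (Fin.last N)
  exact ⟨A, fun j => hA j (Fin.le_last j)⟩

theorem HasBranches.sigma_eq {A lam : TailFamily N} (h : HasBranches A lam) (j : Fin (N + 1)) :
    sigma A j = range (lam j) := by
  ext x
  simp [sigma, h j, eq_comm]

end PeriodicDefects

theorem theorem3 (N : ℕ) :
    -- the direct problem
    (∀ A : TailFamily N,
      (∀ (j : Fin (N + 1)) (k : Cube N), (branch A j k).Subsingleton) ∧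
      spectrum ℂ (periodicOp A) = (fun x : ℝ => (x : ℂ)) '' ⋃ j : Fin (N + 1), sigma A j ∧
      (∀ j : Fin (N + 1), j < Fin.last N →
        (∃ J : ℕ → Set ℝ, (∀ n, (J n).OrdConnected) ∧ sigma A j = ⋃ n, J n) ∧
        ((∀ k : Cube N, (branch A j k).Nonempty) →
          ∃ a b : ℝ, a ≤ b ∧ sigma A j = Set.Icc a b)) ∧
      (∃ J : Fin N → Set ℝ, (∀ i, (J i).OrdConnected ∧ IsCompact (J i)) ∧
        (⋃ j : Fin N, sigma A j.castSucc) = ⋃ i, J i) ∧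
      (sigma A (Fin.last N)).Subsingleton ∧
      (∀ x ∈ sigma A (Fin.last N),
        Module.End.HasEigenvalue (periodicOp A : L2 N →ₗ[ℂ] L2 N) (x : ℂ))) ∧
    -- the inverse problem
    (∀ lam : TailFamily N, NonOverlap lam →
      (∃! T : L2 N →L[ℂ] L2 N, ∃ A : TailFamily N, periodicOp A = T ∧ HasBranches A lam) ∧
      ∃ A : TailFamily N, HasBranches A lam ∧
        (∀ A' : TailFamily N, HasBranches A' lam → A' = A) ∧
        (∀ k : Cube N, A 0 k = lam 0 k) ∧
        (∀ (j : Fin N) (k : Cube N),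
          (∀ t : unitInterval,
            contFrac A j.castSucc (lam j.succ k) (Function.update k j t) ≠ 0) ∧
          MeasureTheory.Integrable (fun t : unitInterval =>
            (contFrac A j.castSucc (lam j.succ k) (Function.update k j t))⁻¹) ∧
          (∫ t : unitInterval,
            (contFrac A j.castSucc (lam j.succ k) (Function.update k j t))⁻¹) ≠ 0 ∧
          A j.succ k =
            -(∫ t : unitInterval,
              (contFrac A j.castSucc (lam j.succ k) (Function.update k j t))⁻¹)⁻¹) ∧
        spectrum ℂ (periodicOp A) =
          (fun x : ℝ => (x : ℂ)) '' ⋃ j : Fin (N + 1), Set.range (lam j)) := by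
  refine ⟨fun A => ⟨branch_subsingleton A, spectrum_periodicOp A,
    fun j _ => ⟨sigma_eq_iUnion_ordConnected A j, sigma_eq_Icc⟩,
    iUnion_sigma_castSucc_eq_iUnion A, sigma_last_subsingleton A,
    fun x hx => hasEigenvalue_of_mem_sigma_last hx⟩, fun lam hlam => ?_⟩
  obtain ⟨A, hA⟩ := exists_hasBranches hlam
  refine ⟨⟨periodicOp A, ⟨A, rfl, hA⟩, ?_⟩, A, hA, fun A' hA' => hA.unique hA',
    coeff_zero_of_branch_eq (hA 0), fun j k => ?_, ?_⟩
  · rintro T ⟨A', rfl, hA'⟩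
    rw [hA.unique hA']
  · have hdom := mem_fracDomain_of_branch_eq hlam j.succ (fun r _ => hA r) k
    have h0 := contFrac_update_ne_zero A j hdom
    exact ⟨h0, integrable_unitInterval ((continuous_contFrac_update A j hdom).inv₀ h0),
      integral_inv_contFrac_ne_zero A j hdom, coeff_succ_of_branch_eq j (hA j.succ) k⟩
  · rw [spectrum_periodicOp]
    simp_rw [hA.sigma_eq]
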